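/- **Proposition (weights for tautological bundles).** Let $k\ge 1$ and let $0\le d_1\le\dots\le d_k=N$ be integers. Let $X$ be the complex manifold of flags $V_1\subseteq\dots\subseteq V_k=\mathbb C^N$ with $\dim V_i=d_i$, let $n=\dim_{\mathbb C}X$, let $H_i=\{(\mathbf F,v)\in X\times\mathbb C^N: v\in V_i\}$ be the tautological holomorphic vector bundles, and let $F_i=(X\times\mathbb C^N)/H_i$, with quotient maps $q_i:X\times\mathbb C^N\to F_i$ and $Q_i:F_i\to F_{i+1}$. Using the Euclidean inner product of $\mathbb C^N$, let $\pi_{H_i}$ be the orthogonal projection onto $H_i$ and let $\varphi_i:F_i\to H_i^{\perp}$ be the inverse of $q_i|_{H_i^\perp}$. Write $(z,\zeta)$ for the points of $X\times X$; a subscript $z$ or $\zeta$ denotes the pullback of a bundle on $X$ under the first or the second projection. Let $E\to X\times X$ be the holomorphic vector bundle of all $\xi=\sum_{i=1}^{k-1}\xi_i$, $\xi_i\in \mathrm{Hom}(H_{i,\zeta},F_{i,z})$, such that $\xi_{i+1}|_{H_{i,\zeta}}=Q_i\circ\xi_i$ for $1\le i\le k-2$, and put $\xi_k=0$. Let $\eta=\sum_{i=1}^{k-1}\eta_i$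 be the section of $E$ with $\eta_i(z,\zeta)v=q_{i,z}(v)$ for $v\in H_{i,\zeta}$. For a holomorphic vector bundle $V\to X$ put $\nabla_\eta=\delta_\eta-\bar\partial$ on smooth sections of $\mathrm{Hom}(V_\zeta,V_z)\otimes\Lambda[E^*\oplus T^*_{0,1}(X\times X)]$, where $\delta_\eta$ is interior multiplication by $\eta$. A *weight* for $V$ is a smooth section $g=g_{0,0}+\dots+g_{n,n}$ of this bundle, with $g_{l,l}$ a section of $\mathrm{Hom}(V_\zeta,V_z)\otimes \Lambda^lE^*\wedge T^*_{0,l}(X\times X)$, such that $\nabla_\eta g=0$ and $g_{0,0}=\mathrm{Id}$ on the diagonal. For $1\le i\le k$ let $\gamma_{0,i}(z,\zeta)v=\pi_{H_{i,z}}v$ for $v\in H_{i,\zeta}$, and for smooth local sections $\xi$ of $E$ and $v$ of $H_{i,\zeta}$ let $$\gamma_{1,i}(\xi\otimes v)=-\pi_{H_{i,z}}\bigl(\bar\partial\,\varphi_i(\xi_i(v))\bigr).$$ Then the value of $\gamma_{1,i}(\xi\otimes v)$ at a point depends only on the values of $\xi$ and $v$ at that point, so that $\gamma_{1,i}$ is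 a section of $\mathrm{Hom}(H_{i,\zeta},H_{i,z})\otimes E^*\otimes T^*_{0,1}(X\times X)$, it is smooth, and $G_i=\gamma_{0,i}+\gamma_{1,i}$ is a weight for $H_i$. -/

import Mathlib

namespace FlagManifold

open scoped Manifold ContDiff Topology
open Set Bundle

noncomputable section

section RingPart

variable {R : Type*} [Ring R]

/-- A chain of idempotents `0 = P 0 ≤ P 1 ≤ ⋯ ≤ P n = 1`. -/
structure IsBlockChain (P : ℕ → R) (n : ℕ) : Prop where
  mul : ∀ i j, P i * P j = P (min i j)
  zero : P 0 = 0
  one : ∀ i, n ≤ i → P i = 1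

/-- Strictly block lower triangular elements with respect to a chain of idempotents. -/
def IsLower (P : ℕ → R) (B : R) : Prop := ∀ j, P (j + 1) * B * (1 - P j) = 0

/-- The leading principal block of `x`, completed by the identity. -/
def lead (P : ℕ → R) (j : ℕ) (x : R) : R := P j * x * P j + (1 - P j)

/-- All leading principal blocks of `x` are invertible. -/
def BigCell (P : ℕ → R) (n : ℕ) (x : R) : Prop := ∀ l ∈ Finset.range n, IsUnit (lead P (l + 1) x)

/-- The block lower unipotent factor of `x`. -/
def lowerFactor (P : ℕ → R) (n : ℕ) (x : R) : R :=
  ∑ l ∈ Finset.range n, x * P (l + 1) * Ring.inverse (lead P (l + 1) x) * (P (l + 1) - P l)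

variable {P : ℕ → R} {n : ℕ}

lemma IsBlockChain.idem (h : IsBlockChain P n) (i : ℕ) : P i * P i = P i := by simpa using h.mul i i

lemma IsBlockChain.mul_le (h : IsBlockChain P n) {i j : ℕ} (hij : i ≤ j) : P i * P j = P i := by
  simpa [hij] using h.mul i j

lemma IsBlockChain.mul_ge (h : IsBlockChain P n) {i j : ℕ} (hij : i ≤ j) : P j * P i = P i := by
  simpa [hij] using h.mul j i

lemma IsLower.isNilpotent (h : IsBlockChain P n) {B : R} (hB : IsLower P B) : IsNilpotent B := by
  have key : ∀ j, P j * B ^ j = 0 := by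
    intro j
    induction j with
    | zero => simp [h.zero]
    | succ j ih =>
      have h1 : P (j + 1) * B = P (j + 1) * B * P j := by
        have := hB j
        rw [mul_sub, mul_one, sub_eq_zero] at this
        exact this
      rw [pow_succ', ← mul_assoc, h1, mul_assoc, ih, mul_zero]
  exact ⟨n, by simpa [h.one n le_rfl] using key n⟩

lemma IsLower.isUnit (h : IsBlockChain P n) {B : R} (hB : IsLower P B) : IsUnit (1 + B) :=
  (hB.isNilpotent h).isUnit_one_add

lemma lead_mul_left (h : IsBlockChain P n) (j : ℕ) (x : R) : P j * lead P j x = P j * x * P j := by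
  have := h.idem j
  simp only [lead, mul_add, mul_sub, mul_one, this, sub_self, add_zero, ← mul_assoc]

lemma IsLower.lead (h : IsBlockChain P n) {B : R} (hB : IsLower P B) (j : ℕ) :
    IsUnit (lead P j (1 + B)) := by
  have e : FlagManifold.lead P j (1 + B) = 1 + P j * B * P j := by
    simp only [FlagManifold.lead, mul_add, add_mul, mul_one, h.idem]; abel
  rw [e]
  refine IsLower.isUnit h (P := P) fun i => ?_
  have h1 : P j * (1 - P i) = (1 - P i) * P j := by
    rw [mul_sub, sub_mul, h.mul, h.mul, min_comm]; simp
  have h2 : P (i + 1) * P j = P j * P (i + 1) := by rw [h.mul, h.mul, min_comm]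
  calc P (i + 1) * (P j * B * P j) * (1 - P i)
      = (P (i + 1) * P j) * B * (P j * (1 - P i)) := by noncomm_ring
    _ = P j * (P (i + 1) * B * (1 - P i)) * P j := by rw [h1, h2]; noncomm_ring
    _ = 0 := by rw [hB i]; simp

lemma IsLower.bigCell (h : IsBlockChain P n) {B : R} (hB : IsLower P B) : BigCell P n (1 + B) :=
  fun l _ => hB.lead h (l + 1)

lemma IsLower.lowerFactor (h : IsBlockChain P n) {B : R} (hB : IsLower P B) :
    lowerFactor P n (1 + B) = 1 + B := by
  have e : ∀ l ∈ Finset.range n, (1 + B) * P (l + 1) *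
      Ring.inverse (FlagManifold.lead P (l + 1) (1 + B)) * (P (l + 1) - P l)
      = (1 + B) * (P (l + 1) - P l) := by
    intro l _
    have hi := h.mul_ge (Nat.le_succ l)
    have h0 : P (l + 1) * (P (l + 1) - P l) = P (l + 1) - P l := by
      rw [mul_sub, h.idem, hi]
    have hB' : P (l + 1) * B * (P (l + 1) - P l) = 0 := by
      have e1 : P (l + 1) - P l = (1 - P l) * P (l + 1) := by
        rw [sub_mul, one_mul, h.mul_le (Nat.le_succ l)]
      rw [e1, ← mul_assoc, hB l, zero_mul]
    have h1 : FlagManifold.lead P (l + 1) (1 + B) * (P (l + 1) - P l) = P (l + 1) - P l := by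
      calc _ = P (l + 1) * (P (l + 1) * (P (l + 1) - P l))
            + P (l + 1) * B * (P (l + 1) * (P (l + 1) - P l))
            + ((P (l + 1) - P l) - P (l + 1) * (P (l + 1) - P l)) := by
              simp only [FlagManifold.lead]; noncomm_ring
        _ = _ := by rw [h0, h0, hB']; simp
    have h2 : Ring.inverse (FlagManifold.lead P (l + 1) (1 + B)) * (P (l + 1) - P l)
        = P (l + 1) - P l := by
      conv_lhs => rw [← h1]
      rw [← mul_assoc, Ring.inverse_mul_cancel _ (hB.lead h _), one_mul]
    rw [mul_assoc, h2, mul_assoc, h0]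
  rw [FlagManifold.lowerFactor, Finset.sum_congr rfl e, ← Finset.mul_sum,
    Finset.sum_range_sub, h.zero, h.one n le_rfl, sub_zero, mul_one]

lemma isLower_lowerFactor (h : IsBlockChain P n) {x : R} (hx : BigCell P n x) :
    IsLower P (lowerFactor P n x - 1) := by
  intro j
  have hterm : ∀ l ∈ Finset.range n,
      P (j + 1) * (x * P (l + 1) * Ring.inverse (lead P (l + 1) x) * (P (l + 1) - P l)) * (1 - P j)
      = P (j + 1) * (P (l + 1) - P l) * (1 - P j) := by
    intro l hl
    rcases lt_or_ge l j with hlj | hlj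
    · have : (P (l + 1) - P l) * (1 - P j) = 0 := by
        rw [mul_sub, mul_one, sub_mul, h.mul_le (by omega), h.mul_le hlj.le, sub_self]
      simp only [mul_assoc, this, mul_zero]
    · congr 1
      have h0 : P (l + 1) * (P (l + 1) - P l) = P (l + 1) - P l := by
        rw [mul_sub, h.idem, h.mul_ge (Nat.le_succ l)]
      calc _ = (P (j + 1) * P (l + 1)) * (x * P (l + 1) * Ring.inverse (lead P (l + 1) x)
              * (P (l + 1) - P l)) := by
              rw [h.mul_le (by omega : j + 1 ≤ l + 1)]
        _ = P (j + 1) * ((P (l + 1) * x * P (l + 1)) * Ring.inverse (lead P (l + 1) x)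
              * (P (l + 1) - P l)) := by noncomm_ring
        _ = P (j + 1) * (P (l + 1) * (P (l + 1) - P l)) := by
              rw [← lead_mul_left h, mul_assoc (P (l + 1)), Ring.mul_inverse_cancel _ (hx l hl),
                mul_one]
        _ = _ := by rw [h0]
  have h1 : P (j + 1) * lowerFactor P n x * (1 - P j) = P (j + 1) * (1 - P j) := by
    rw [lowerFactor, Finset.mul_sum, Finset.sum_mul, Finset.sum_congr rfl hterm, ← Finset.sum_mul,
      ← Finset.mul_sum, Finset.sum_range_sub, h.zero, h.one n le_rfl, sub_zero, mul_one]
  rw [mul_sub (P (j + 1)), sub_mul _ _ (1 - P j), h1, mul_one, sub_self]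

lemma lowerFactor_mul_P (h : IsBlockChain P n) (x : R) (j : ℕ) :
    ∃ y, lowerFactor P n x * P j = x * (P j * y) := by
  refine ⟨∑ l ∈ Finset.range n, P (l + 1) * Ring.inverse (lead P (l + 1) x)
    * ((P (l + 1) - P l) * P j), ?_⟩
  rw [lowerFactor, Finset.sum_mul, Finset.mul_sum, Finset.mul_sum]
  refine Finset.sum_congr rfl fun l _ => ?_
  rcases lt_or_ge l j with hlj | hlj
  · rw [← mul_assoc (P j), ← mul_assoc (P j), h.mul_ge (by omega : l + 1 ≤ j)]
    simp only [mul_assoc]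
  · have : (P (l + 1) - P l) * P j = 0 := by
      rw [sub_mul, h.mul_ge hlj, h.mul_ge (by omega : j ≤ l + 1), sub_self]
    simp only [mul_assoc, this, mul_zero]

lemma lead_mul_right {x b : R} {j : ℕ} (h : IsBlockChain P n) (hb : b * P j = P j * b * P j) :
    lead P j (x * b) = lead P j x * lead P j b := by
  have hi := h.idem j
  have e1 : P j * x * P j * (P j * b * P j) = P j * (x * b) * P j := by
    calc _ = P j * x * ((P j * P j) * b * P j) := by noncomm_ring
      _ = _ := by rw [hi, ← hb]; noncomm_ring
  have e2 : P j * (1 - P j) = 0 := by rw [mul_sub, hi, mul_one, sub_self]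
  have e3 : (1 - P j) * P j = 0 := by rw [sub_mul, hi, one_mul, sub_self]
  have e4 : (1 - P j) * (1 - P j) = 1 - P j := by rw [mul_sub, e3, mul_one, sub_zero]
  rw [lead, lead, lead, add_mul, mul_add, mul_add, e1, e4]
  have e5 : P j * x * P j * (1 - P j) = 0 := by rw [mul_assoc, e2, mul_zero]
  have e6 : (1 - P j) * (P j * b * P j) = 0 := by
    rw [← mul_assoc, ← mul_assoc, e3, zero_mul, zero_mul]
  rw [e5, e6]; abel

lemma lead_one (h : IsBlockChain P n) (j : ℕ) : lead P j (1 : R) = 1 := by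
  rw [lead, mul_one, h.idem]; abel

lemma isUnit_lead (h : IsBlockChain P n) {b : Rˣ} (j : ℕ)
    (hb : (b : R) * P j = P j * b * P j) (hb' : ((b⁻¹ : Rˣ) : R) * P j = P j * ((b⁻¹ : Rˣ) : R) * P j) :
    IsUnit (lead P j (b : R)) := by
  refine ⟨⟨lead P j (b : R), lead P j ((b⁻¹ : Rˣ) : R), ?_, ?_⟩, rfl⟩
  · rw [← lead_mul_right h hb', Units.mul_inv, lead_one h]
  · rw [← lead_mul_right h hb, Units.inv_mul, lead_one h]

lemma BigCell.mul (h : IsBlockChain P n) {x : R} (hx : BigCell P n x) {b : Rˣ}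
    (hb : ∀ j, (b : R) * P j = P j * b * P j)
    (hb' : ∀ j, ((b⁻¹ : Rˣ) : R) * P j = P j * ((b⁻¹ : Rˣ) : R) * P j) :
    BigCell P n (x * b) := fun l hl => by
  rw [lead_mul_right h (hb _)]
  exact (hx l hl).mul (isUnit_lead h _ (hb _) (hb' _))

lemma lowerFactor_mul (h : IsBlockChain P n) {x : R} (hx : BigCell P n x) {b : Rˣ}
    (hb : ∀ j, (b : R) * P j = P j * b * P j)
    (hb' : ∀ j, ((b⁻¹ : Rˣ) : R) * P j = P j * ((b⁻¹ : Rˣ) : R) * P j) :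
    lowerFactor P n (x * b) = lowerFactor P n x := by
  refine Finset.sum_congr rfl fun l hl => ?_
  have hu := isUnit_lead h (l + 1) (hb _) (hb' _)
  obtain ⟨u, hu'⟩ := hu
  obtain ⟨v, hv⟩ := hx l hl
  rw [lead_mul_right h (hb _), ← hu', ← hv, ← Units.val_mul, Ring.inverse_unit, Ring.inverse_unit,
    mul_inv_rev, Units.val_mul]
  have e : (b : R) * P (l + 1) * ((u⁻¹ : Rˣ) : R) = P (l + 1) := by
    rw [hb, ← lead_mul_left h, ← hu', mul_assoc, Units.mul_inv, mul_one]
  calc _ = x * ((b : R) * P (l + 1) * ((u⁻¹ : Rˣ) : R)) * ((v⁻¹ : Rˣ) : R) * (P (l + 1) - P l) := by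
        noncomm_ring
    _ = _ := by rw [e]

end RingPart

/-! ### Flags -/

/-- The dimensions `d 0 ≤ d 1 ≤ ⋯ ≤ d m = N` of the subspaces of a flag in `ℂ^N`
(the flag has `m + 1` members). -/
structure FlagType (m N : ℕ) where
  d : Fin (m + 1) → ℕ
  mono : Monotone d
  last : d (Fin.last m) = N

/-- The vector space `ℂ^N` with its Euclidean inner product. -/
abbrev Vec (N : ℕ) : Type := EuclideanSpace ℂ (Fin N)

/-- The algebra of (continuous) linear endomorphisms of `ℂ^N`, a matrix algebra. -/
abbrev Mat (N : ℕ) : Type := Vec N →L[ℂ] Vec N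

lemma mat_mul_apply {N : ℕ} (A B : Mat N) (v : Vec N) : (A * B) v = A (B v) := rfl

/-- The projection of `ℂ^N` onto the first `c` coordinates. -/
def coordProj (N c : ℕ) : Mat N :=
  LinearMap.toContinuousLinearMap
    { toFun := fun v => WithLp.toLp 2 fun a : Fin N => if a.val < c then v a else 0
      map_add' := fun v w => by
        ext a; by_cases h : a.val < c <;> simp [h]
      map_smul' := fun s v => by
        ext a; by_cases h : a.val < c <;> simp [h] }

@[simp] lemma coordProj_apply (N c : ℕ) (v : Vec N) (a : Fin N) :
    coordProj N c v a = if a.val < c then v a else 0 := rfl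

lemma coordProj_mul (N c c' : ℕ) : coordProj N c * coordProj N c' = coordProj N (min c c') := by
  ext v a
  by_cases h : a.val < c <;> by_cases h' : a.val < c' <;>
    simp [h, h']

variable {m N : ℕ}

namespace FlagType

variable (t : FlagType m N)

lemma d_le (j : Fin (m + 1)) : t.d j ≤ N := (t.mono (Fin.le_last j)).trans_eq t.last

/-- The sequence `0, d 0, d 1, …, d m, N, N, …`. -/
def dim : ℕ → ℕ
  | 0 => 0
  | j + 1 => if h : j < m + 1 then t.d ⟨j, h⟩ else N

@[simp] lemma dim_succ (j : Fin (m + 1)) : t.dim (j.val + 1) = t.d j := by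
  simp [dim, j.isLt]

lemma dim_mono : Monotone t.dim := by
  refine monotone_nat_of_le_succ fun j => ?_
  cases j with
  | zero => exact Nat.zero_le _
  | succ j =>
    by_cases h : j + 1 < m + 1
    · have h' : j < m + 1 := by omega
      simp only [dim, h, h', dif_pos]
      exact t.mono (Fin.mk_le_mk.2 (Nat.le_succ j))
    · by_cases h' : j < m + 1
      · simp only [dim, h, h', dif_pos, dif_neg, not_false_eq_true]
        exact t.d_le _
      · simp [dim, h, h']

/-- The coordinate projections onto the members of the reference flag. -/
def P (j : ℕ) : Mat N := coordProj N (t.dim j)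

lemma dim_of_le {j : ℕ} (hj : m + 1 ≤ j) : t.dim j = N := by
  refine le_antisymm ?_ ?_
  · cases j with
    | zero => omega
    | succ j =>
      by_cases h' : j < m + 1
      · simpa only [dim, h', dif_pos] using t.d_le _
      · simp [dim, h']
  · have := t.dim_mono hj
    rwa [show m + 1 = (Fin.last m).val + 1 from rfl, t.dim_succ, t.last] at this

lemma isChain : IsBlockChain t.P (m + 1) where
  mul i j := by
    rw [P, P, P, coordProj_mul, t.dim_mono.map_min]
  zero := by ext v a; simp [P, dim]
  one i hi := by ext v a; simp [P, t.dim_of_le hi]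

/-- The `j`-th member of the reference flag: the span of the first `d j` basis vectors. -/
def refSub (j : Fin (m + 1)) : Submodule ℂ (Vec N) :=
  Submodule.span ℂ (Set.range fun a : {a : Fin N // a.val < t.d j} =>
    EuclideanSpace.single a.val (1 : ℂ))

lemma mem_refSub {j : Fin (m + 1)} {v : Vec N} : v ∈ t.refSub j ↔ t.P (j.val + 1) v = v := by
  rw [P, dim_succ]
  constructor
  · intro h
    have : t.refSub j ≤ LinearMap.eqLocus (coordProj N (t.d j) : Vec N →ₗ[ℂ] Vec N)
        LinearMap.id := by
      rw [refSub, Submodule.span_le]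
      rintro _ ⟨a, rfl⟩
      change coordProj N (t.d j) (EuclideanSpace.single a.val 1) = EuclideanSpace.single a.val 1
      ext b
      by_cases hb : b = a.val
      · subst hb; simp [a.2]
      · simp [hb]
    exact this h
  · intro h
    have hv : v = ∑ a, v a • EuclideanSpace.single a (1 : ℂ) := by
      ext b; simp [Pi.single_apply]
    rw [hv]
    refine Submodule.sum_mem _ fun a _ => ?_
    by_cases ha : a.val < t.d j
    · exact Submodule.smul_mem _ _ (Submodule.subset_span ⟨⟨a, ha⟩, rfl⟩)
    · have : v a = 0 := by
        rw [← h]; simp [ha]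
      simp [this]

lemma P_mem (j : Fin (m + 1)) (v : Vec N) : t.P (j.val + 1) v ∈ t.refSub j := by
  rw [mem_refSub, ← mat_mul_apply, t.isChain.idem]

lemma refSub_mono : Monotone t.refSub := fun i j hij v hv => by
  rw [mem_refSub] at hv ⊢
  rw [← hv, ← mat_mul_apply, t.isChain.mul_ge (Nat.succ_le_succ hij)]

lemma finrank_refSub (j : Fin (m + 1)) : Module.finrank ℂ (t.refSub j) = t.d j := by
  rw [refSub, finrank_span_eq_card]
  · rw [Fintype.card_subtype]
    have := t.d_le j
    have e : (Finset.univ.filter fun a : Fin N => a.val < t.d j).card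
        = (Finset.range (t.d j)).card := by
      refine Finset.card_bij (fun a _ => a.val) ?_ ?_ ?_
      · intro a ha; simpa using ha
      · intro a _ b _ h; exact Fin.ext h
      · intro b hb
        have hb' : b < t.d j := by simpa using hb
        exact ⟨⟨b, by omega⟩, by simpa using hb', rfl⟩
    rw [e, Finset.card_range]
  · exact (EuclideanSpace.orthonormal_single (𝕜 := ℂ) (ι := Fin N)).linearIndependent.comp
      (fun a : {a : Fin N // a.val < t.d j} => a.val) Subtype.val_injective

end FlagType

/-- The flag manifold `X`: flags `V 0 ⊆ V 1 ⊆ ⋯ ⊆ V m = ℂ^N` with `dim V j = d j`. -/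
@[ext] structure FlagMfd (t : FlagType m N) where
  V : Fin (m + 1) → Submodule ℂ (Vec N)
  mono : Monotone V
  finrank_eq : ∀ j, Module.finrank ℂ (V j) = t.d j

variable {t : FlagType m N}

/-- The flag `x F₀`, for `x ∈ GL(N, ℂ)` and `F₀` the reference flag. -/
def FlagMfd.ofGL (t : FlagType m N) (x : (Mat N)ˣ) : FlagMfd t where
  V j := (t.refSub j).map ((x : Mat N) : Vec N →ₗ[ℂ] Vec N)
  mono _ _ hij := Submodule.map_mono (t.refSub_mono hij)
  finrank_eq j :=
    (LinearEquiv.finrank_map_eq (ContinuousLinearEquiv.unitsEquiv ℂ (Vec N) x).toLinearEquiv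
      (t.refSub j)).trans (t.finrank_refSub j)

lemma inv_apply_apply (x : (Mat N)ˣ) (v : Vec N) : ((x⁻¹ : (Mat N)ˣ) : Mat N) ((x : Mat N) v) = v := by
  rw [← mat_mul_apply, Units.inv_mul]; rfl

lemma apply_inv_apply (x : (Mat N)ˣ) (v : Vec N) : (x : Mat N) (((x⁻¹ : (Mat N)ˣ) : Mat N) v) = v := by
  rw [← mat_mul_apply, Units.mul_inv]; rfl

lemma exists_extend_equiv {W W' : Type*} [AddCommGroup W] [Module ℂ W] [FiniteDimensional ℂ W]
    [AddCommGroup W'] [Module ℂ W'] [FiniteDimensional ℂ W'] (A : Submodule ℂ W)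
    (e : A →ₗ[ℂ] W') (he : Function.Injective e)
    (h : Module.finrank ℂ W = Module.finrank ℂ W') :
    ∃ f : W ≃ₗ[ℂ] W', ∀ a : A, f a = e a := by
  obtain ⟨C, hC⟩ := Submodule.exists_isCompl A
  obtain ⟨C', hC'⟩ := Submodule.exists_isCompl (LinearMap.range e)
  have h1 := Submodule.finrank_add_eq_of_isCompl hC
  have h2 := Submodule.finrank_add_eq_of_isCompl hC'
  have h3 := LinearMap.finrank_range_of_inj he
  let g : C ≃ₗ[ℂ] C' := LinearEquiv.ofFinrankEq _ _ (by omega)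
  let e1 := LinearEquiv.ofInjective e he
  refine ⟨(Submodule.prodEquivOfIsCompl A C hC).symm.trans
    ((e1.prodCongr g).trans (Submodule.prodEquivOfIsCompl _ C' hC')), fun a => ?_⟩
  simp [e1]

lemma FlagMfd.V_last (F : FlagMfd t) : F.V (Fin.last m) = ⊤ := by
  apply Submodule.eq_top_of_finrank_eq
  rw [F.finrank_eq, t.last]; simp

/-- `GL(N, ℂ)` acts transitively on the flag manifold. -/
lemma FlagMfd.exists_ofGL_eq (F : FlagMfd t) : ∃ x : (Mat N)ˣ, FlagMfd.ofGL t x = F := by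
  have key : ∀ j : Fin (m + 1), ∃ φ : t.refSub j ≃ₗ[ℂ] F.V j,
      ∀ l, l ≤ j → ∀ v : t.refSub j, v.1 ∈ t.refSub l → (φ v).1 ∈ F.V l := by
    intro j
    induction j using Fin.induction with
    | zero =>
      refine ⟨LinearEquiv.ofFinrankEq _ _ (by rw [t.finrank_refSub, F.finrank_eq]), ?_⟩
      intro l hl v _
      obtain rfl : l = 0 := le_antisymm hl (Fin.zero_le _)
      exact Subtype.property _
    | succ j ih =>
      obtain ⟨φ, hφ⟩ := ih
      have hle : t.refSub j.castSucc ≤ t.refSub j.succ := t.refSub_mono (Fin.castSucc_le_succ j)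
      have hle' : F.V j.castSucc ≤ F.V j.succ := F.mono (Fin.castSucc_le_succ j)
      let A := (t.refSub j.castSucc).comap (t.refSub j.succ).subtype
      let i0 : A ≃ₗ[ℂ] t.refSub j.castSucc := Submodule.comapSubtypeEquivOfLe hle
      obtain ⟨f, hf⟩ := exists_extend_equiv A
        ((Submodule.inclusion hle').comp (φ.toLinearMap.comp i0.toLinearMap))
        ((Submodule.inclusion_injective hle').comp (φ.injective.comp i0.injective))
        (by rw [t.finrank_refSub, F.finrank_eq])
      refine ⟨f, fun l hl v hv => ?_⟩
      rcases hl.eq_or_lt with rfl | hlt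
      · exact Subtype.property _
      · have hlj : l ≤ j.castSucc := Fin.le_castSucc_iff.2 hlt
        have hvA : v ∈ A := t.refSub_mono hlj hv
        have := hf ⟨v, hvA⟩
        rw [show f v = _ from this]
        exact hφ l hlj _ hv
  obtain ⟨φ, hφ⟩ := key (Fin.last m)
  have h0 : t.refSub (Fin.last m) = ⊤ := by
    apply Submodule.eq_top_of_finrank_eq
    rw [t.finrank_refSub, t.last]; simp
  let ψ : Vec N ≃ₗ[ℂ] Vec N := (LinearEquiv.ofTop _ h0).symm.trans
    (φ.trans (LinearEquiv.ofTop _ F.V_last))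
  refine ⟨(ContinuousLinearEquiv.unitsEquiv ℂ (Vec N)).symm ψ.toContinuousLinearEquiv, ?_⟩
  ext1
  funext l
  refine Submodule.eq_of_le_of_finrank_eq ?_ ?_
  · rintro _ ⟨v, hv, rfl⟩
    exact hφ l (Fin.le_last l) ⟨v, h0 ▸ Submodule.mem_top⟩ hv
  · rw [FlagMfd.finrank_eq, FlagMfd.finrank_eq]

/-- `x` and `y` give the same flag exactly if they differ by an element of the parabolic
subgroup of block upper triangular matrices. -/
lemma ofGL_eq_iff {x y : (Mat N)ˣ} : FlagMfd.ofGL t x = FlagMfd.ofGL t y ↔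
    ∀ j, ((x⁻¹ * y : (Mat N)ˣ) : Mat N) * t.P j = t.P j * ((x⁻¹ * y : (Mat N)ˣ) : Mat N) * t.P j := by
  constructor
  · intro h j
    rcases j with _ | j
    · simp [t.isChain.zero]
    by_cases hj : m + 1 ≤ j + 1
    · simp [t.isChain.one _ hj]
    ext1 v
    have hj' : j < m + 1 := by omega
    have h1 : (y : Mat N) (t.P (j + 1) v) ∈ (FlagMfd.ofGL t x).V ⟨j, hj'⟩ := by
      rw [h]; exact ⟨_, t.P_mem ⟨j, hj'⟩ v, rfl⟩
    obtain ⟨w, hw, hw'⟩ := h1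
    have hw'' : (x : Mat N) w = (y : Mat N) (t.P (j + 1) v) := hw'
    have : ((x⁻¹ * y : (Mat N)ˣ) : Mat N) (t.P (j + 1) v) = w := by
      rw [Units.val_mul, mat_mul_apply, ← hw'', inv_apply_apply]
    have hw2 := t.mem_refSub.1 hw
    change ((x⁻¹ * y : (Mat N)ˣ) : Mat N) (t.P (j + 1) v)
      = t.P (j + 1) (((x⁻¹ * y : (Mat N)ˣ) : Mat N) (t.P (j + 1) v))
    rw [this]; exact hw2.symm
  · intro h
    symm
    ext1
    funext l
    refine Submodule.eq_of_le_of_finrank_eq ?_ (by rw [FlagMfd.finrank_eq, FlagMfd.finrank_eq])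
    rintro _ ⟨v, hv, rfl⟩
    have hv' := t.mem_refSub.1 hv
    refine ⟨((x⁻¹ * y : (Mat N)ˣ) : Mat N) v, ?_, ?_⟩
    · rw [← hv', ← mat_mul_apply, h]
      exact t.P_mem l _
    · change (x : Mat N) (((x⁻¹ * y : (Mat N)ˣ) : Mat N) v) = (y : Mat N) v
      rw [Units.val_mul, mat_mul_apply, apply_inv_apply]

/-- A matrix representing a flag. -/
def FlagMfd.rep (F : FlagMfd t) : (Mat N)ˣ := F.exists_ofGL_eq.choose

@[simp] lemma FlagMfd.ofGL_rep (F : FlagMfd t) : FlagMfd.ofGL t F.rep = F := F.exists_ofGL_eq.choose_spec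

/-- The topology of `X = GL(N, ℂ) / P`. -/
instance : TopologicalSpace (FlagMfd t) := TopologicalSpace.coinduced (FlagMfd.ofGL t) inferInstance

lemma isQuotientMap_ofGL : Topology.IsQuotientMap (FlagMfd.ofGL t) :=
  ⟨⟨rfl⟩, fun F => F.exists_ofGL_eq⟩

variable (t) in
/-- The nilpotent algebra of strictly block lower triangular matrices, which is the model space
of `X`. -/
def Nil : Submodule ℂ (Mat N) where
  carrier := {B | IsLower t.P B}
  add_mem' {A B} hA hB j := by
    have h1 := hA j
    have h2 := hB j
    rw [mul_add, add_mul, h1, h2, add_zero]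
  zero_mem' j := by simp
  smul_mem' c B hB j := by
    rw [mul_smul_comm, smul_mul_assoc, hB j, smul_zero]

instance : NormedAddCommGroup (Nil t) := Submodule.normedAddCommGroup (Nil t)

instance : NormedSpace ℂ (Nil t) := Submodule.normedSpace (Nil t)

instance : FiniteDimensional ℂ (Nil t) := FiniteDimensional.finiteDimensional_submodule (Nil t)

lemma exists_proj {E : Type*} [NormedAddCommGroup E] [NormedSpace ℂ E] [FiniteDimensional ℂ E]
    (W : Submodule ℂ E) : ∃ f : E →L[ℂ] W, ∀ w : W, f w = w := by
  obtain ⟨f, hf⟩ := LinearMap.exists_leftInverse_of_injective W.subtype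
    (LinearMap.ker_eq_bot.2 W.injective_subtype)
  exact ⟨LinearMap.toContinuousLinearMap f, fun w => LinearMap.congr_fun hf w⟩

variable (t) in
/-- A linear retraction of all matrices onto `Nil`. -/
def nilProj : Mat N →L[ℂ] Nil t := (exists_proj (Nil t)).choose

lemma nilProj_coe (B : Nil t) : nilProj t B = B := (exists_proj (Nil t)).choose_spec B

variable (t) in
/-- The unipotent matrix `1 + B`. -/
def unip (B : Nil t) : (Mat N)ˣ := (IsLower.isUnit t.isChain B.2).unit

@[simp] lemma unip_val (B : Nil t) : (unip t B : Mat N) = 1 + B.1 := rfl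

lemma continuous_unip : Continuous (unip t) :=
  Units.isOpenEmbedding_val.isInducing.continuous_iff.2
    (continuous_const.add continuous_subtype_val)

lemma ofGL_mul_left {x y : (Mat N)ˣ} (g : (Mat N)ˣ) (h : FlagMfd.ofGL t x = FlagMfd.ofGL t y) :
    FlagMfd.ofGL t (g * x) = FlagMfd.ofGL t (g * y) := by
  rw [ofGL_eq_iff] at h ⊢
  rwa [show (g * x)⁻¹ * (g * y) = x⁻¹ * y by group]

lemma bigCell_of_ofGL_eq {x y : (Mat N)ˣ} (h : FlagMfd.ofGL t x = FlagMfd.ofGL t y)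
    (hx : BigCell t.P (m + 1) (x : Mat N)) :
    BigCell t.P (m + 1) (y : Mat N) ∧
      lowerFactor t.P (m + 1) (y : Mat N) = lowerFactor t.P (m + 1) (x : Mat N) := by
  have h1 := ofGL_eq_iff.1 h
  have h2 := ofGL_eq_iff.1 h.symm
  rw [show y⁻¹ * x = (x⁻¹ * y)⁻¹ by group] at h2
  have e : (y : Mat N) = x * ((x⁻¹ * y : (Mat N)ˣ) : Mat N) := by
    rw [← Units.val_mul]; congr 1; group
  rw [e]
  exact ⟨hx.mul t.isChain h1 h2, lowerFactor_mul t.isChain hx h1 h2⟩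

lemma ofGL_unip_lowerFactor {x : (Mat N)ˣ} (hx : BigCell t.P (m + 1) (x : Mat N)) :
    FlagMfd.ofGL t (unip t ⟨_, isLower_lowerFactor t.isChain hx⟩) = FlagMfd.ofGL t x := by
  ext1
  funext l
  refine Submodule.eq_of_le_of_finrank_eq ?_ (by rw [FlagMfd.finrank_eq, FlagMfd.finrank_eq])
  rintro _ ⟨v, hv, rfl⟩
  have hv' := t.mem_refSub.1 hv
  obtain ⟨y, hy⟩ := lowerFactor_mul_P t.isChain (x : Mat N) (l.val + 1)
  refine ⟨t.P (l.val + 1) (y v), t.P_mem l _, ?_⟩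
  have e : ((unip t ⟨_, isLower_lowerFactor t.isChain hx⟩ : (Mat N)ˣ) : Mat N)
      = lowerFactor t.P (m + 1) (x : Mat N) := by rw [unip_val]; exact add_sub_cancel _ _
  change (x : Mat N) (t.P (l.val + 1) (y v)) =
    ((unip t ⟨_, isLower_lowerFactor t.isChain hx⟩ : (Mat N)ˣ) : Mat N) v
  rw [e]
  conv_rhs => rw [← hv']
  exact (DFunLike.congr_fun hy v).symm

lemma isOpen_bigCell : IsOpen {x : Mat N | BigCell t.P (m + 1) x} := by
  have : {x : Mat N | BigCell t.P (m + 1) x}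
      = ⋂ l ∈ Finset.range (m + 1), {x | IsUnit (lead t.P (l + 1) x)} := by
    ext x; simp [BigCell]
  rw [this]
  refine isOpen_biInter_finset fun l _ => Units.isOpen.preimage ?_
  unfold lead; fun_prop

lemma contDiffOn_lowerFactor :
    ContDiffOn ℂ ω (lowerFactor t.P (m + 1)) {x : Mat N | BigCell t.P (m + 1) x} := by
  unfold lowerFactor
  refine ContDiffOn.sum fun l hl => ?_
  refine ContDiffOn.mul (ContDiffOn.mul (contDiffOn_id.mul contDiffOn_const) ?_) contDiffOn_const
  intro x hx
  obtain ⟨u, hu⟩ := hx l hl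
  have h1 : ContDiffAt ℂ ω Ring.inverse (lead t.P (l + 1) x) := by
    rw [← hu]; exact contDiffAt_ringInverse ℂ u
  have h2 : ContDiff ℂ ω (lead t.P (l + 1)) := by unfold lead; fun_prop
  exact (h1.comp x h2.contDiffAt).contDiffWithinAt

lemma bigCell_rep_iff (g y : (Mat N)ˣ) :
    BigCell t.P (m + 1) ((g⁻¹ * (FlagMfd.ofGL t y).rep : (Mat N)ˣ) : Mat N) ↔
      BigCell t.P (m + 1) ((g⁻¹ * y : (Mat N)ˣ) : Mat N) := by
  have h := ofGL_mul_left g⁻¹ (FlagMfd.ofGL_rep (FlagMfd.ofGL t y))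
  exact ⟨fun hy => (bigCell_of_ofGL_eq h hy).1, fun hy => (bigCell_of_ofGL_eq h.symm hy).1⟩

lemma preimage_source (g : (Mat N)ˣ) :
    FlagMfd.ofGL t ⁻¹' {F | BigCell t.P (m + 1) ((g⁻¹ * F.rep : (Mat N)ˣ) : Mat N)}
      = (fun y : (Mat N)ˣ => ((g⁻¹ * y : (Mat N)ˣ) : Mat N)) ⁻¹'
        {x : Mat N | BigCell t.P (m + 1) x} :=
  Set.ext fun y => bigCell_rep_iff g y

lemma continuous_mulLeft_val (g : (Mat N)ˣ) :
    Continuous (fun y : (Mat N)ˣ => ((g⁻¹ * y : (Mat N)ˣ) : Mat N)) :=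
  Units.continuous_val.comp (continuous_const.mul continuous_id)

lemma isOpen_source (g : (Mat N)ˣ) :
    IsOpen {F : FlagMfd t | BigCell t.P (m + 1) ((g⁻¹ * F.rep : (Mat N)ˣ) : Mat N)} := by
  refine isQuotientMap_ofGL.isOpen_preimage.1 ?_
  rw [preimage_source]
  exact isOpen_bigCell.preimage (continuous_mulLeft_val g)

/-- The holomorphic chart of `X` whose inverse is `B ↦ g (1 + B) F₀`. -/
def flagChart (g : (Mat N)ˣ) : OpenPartialHomeomorph (FlagMfd t) (Nil t) where
  toFun F := nilProj t (lowerFactor t.P (m + 1) ((g⁻¹ * F.rep : (Mat N)ˣ) : Mat N) - 1)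
  invFun B := FlagMfd.ofGL t (g * unip t B)
  source := {F | BigCell t.P (m + 1) ((g⁻¹ * F.rep : (Mat N)ˣ) : Mat N)}
  target := univ
  map_source' _ _ := mem_univ _
  map_target' B _ := by
    have h : FlagMfd.ofGL t (unip t B) =
        FlagMfd.ofGL t (g⁻¹ * (FlagMfd.ofGL t (g * unip t B)).rep) := by
      have := ofGL_mul_left g⁻¹ (FlagMfd.ofGL_rep (FlagMfd.ofGL t (g * unip t B))).symm
      rwa [inv_mul_cancel_left] at this
    exact (bigCell_of_ofGL_eq h (IsLower.bigCell t.isChain B.2)).1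
  left_inv' F hF := by
    have h0 := nilProj_coe (t := t) ⟨_, isLower_lowerFactor t.isChain hF⟩
    have h1 := ofGL_mul_left g (ofGL_unip_lowerFactor hF)
    rw [mul_inv_cancel_left, FlagMfd.ofGL_rep] at h1
    rw [← h0] at h1
    exact h1
  right_inv' B _ := by
    have h : FlagMfd.ofGL t (unip t B) =
        FlagMfd.ofGL t (g⁻¹ * (FlagMfd.ofGL t (g * unip t B)).rep) := by
      have := ofGL_mul_left g⁻¹ (FlagMfd.ofGL_rep (FlagMfd.ofGL t (g * unip t B))).symm
      rwa [inv_mul_cancel_left] at this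
    have h2 := (bigCell_of_ofGL_eq h (IsLower.bigCell t.isChain B.2)).2
    rw [h2, unip_val, IsLower.lowerFactor t.isChain B.2, add_sub_cancel_left, nilProj_coe]
  open_source := isOpen_source g
  open_target := isOpen_univ
  continuousOn_toFun := by
    rw [isQuotientMap_ofGL.continuousOn_isOpen_iff (isOpen_source g)]
    have h1 : ContinuousOn (fun y : (Mat N)ˣ =>
        nilProj t (lowerFactor t.P (m + 1) ((g⁻¹ * y : (Mat N)ˣ) : Mat N) - 1))
        (FlagMfd.ofGL t ⁻¹' {F | BigCell t.P (m + 1) ((g⁻¹ * F.rep : (Mat N)ˣ) : Mat N)}) := by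
      rw [preimage_source]
      refine (nilProj t).continuous.comp_continuousOn (ContinuousOn.sub ?_ continuousOn_const)
      exact contDiffOn_lowerFactor.continuousOn.comp (continuous_mulLeft_val g).continuousOn
        (fun y hy => hy)
    refine h1.congr fun y hy => ?_
    have h := ofGL_mul_left g⁻¹ (FlagMfd.ofGL_rep (FlagMfd.ofGL t y))
    change nilProj t (lowerFactor t.P (m + 1) _ - 1) =
      nilProj t (lowerFactor t.P (m + 1) ((g⁻¹ * y : (Mat N)ˣ) : Mat N) - 1)
    rw [(bigCell_of_ofGL_eq h.symm (bigCell_of_ofGL_eq h hy).1).2]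
  continuousOn_invFun :=
    (isQuotientMap_ofGL.continuous.comp (continuous_const.mul continuous_unip)).continuousOn

lemma flagChart_symm_apply (g : (Mat N)ˣ) (B : Nil t) :
    (flagChart (t := t) g).symm B = FlagMfd.ofGL t (g * unip t B) := rfl

lemma flagChart_ofGL {g y : (Mat N)ˣ}
    (hy : FlagMfd.ofGL t y ∈ (flagChart (t := t) g).source) :
    BigCell t.P (m + 1) ((g⁻¹ * y : (Mat N)ˣ) : Mat N) ∧
    flagChart g (FlagMfd.ofGL t y) =
      nilProj t (lowerFactor t.P (m + 1) ((g⁻¹ * y : (Mat N)ˣ) : Mat N) - 1) := by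
  have h := ofGL_mul_left g⁻¹ (FlagMfd.ofGL_rep (FlagMfd.ofGL t y))
  refine ⟨(bigCell_of_ofGL_eq h hy).1, ?_⟩
  change nilProj t (lowerFactor t.P (m + 1) _ - 1) = _
  rw [(bigCell_of_ofGL_eq h hy).2]

lemma mem_flagChart_rep (F : FlagMfd t) : F ∈ (flagChart (t := t) F.rep).source := by
  change BigCell t.P (m + 1) ((F.rep⁻¹ * F.rep : (Mat N)ˣ) : Mat N)
  rw [inv_mul_cancel, Units.val_one]
  simpa using IsLower.bigCell t.isChain (Nil t).zero_mem

/-- The complex charts of the flag manifold. -/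
instance : ChartedSpace (Nil t) (FlagMfd t) where
  atlas := Set.range flagChart
  chartAt := fun F => flagChart F.rep
  mem_chart_source := mem_flagChart_rep
  chart_mem_atlas _ := ⟨_, rfl⟩

/-- The flag manifold is a complex manifold. -/
instance : IsManifold 𝓘(ℂ, Nil t) ω (FlagMfd t) := by
  refine isManifold_of_contDiffOn _ _ _ ?_
  rintro _ _ ⟨g, rfl⟩ ⟨h, rfl⟩
  have h1 : ContDiffOn ℂ ω (fun B : Nil t => nilProj t (lowerFactor t.P (m + 1)
      (((h⁻¹ * g : (Mat N)ˣ) : Mat N) * (1 + (B : Mat N))) - 1))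
      {B | BigCell t.P (m + 1) (((h⁻¹ * g : (Mat N)ˣ) : Mat N) * (1 + (B : Mat N)))} := by
    refine (nilProj t).contDiff.comp_contDiffOn (ContDiffOn.sub ?_ contDiffOn_const)
    refine contDiffOn_lowerFactor.comp (s := {B : Nil t | BigCell t.P (m + 1)
      (((h⁻¹ * g : (Mat N)ˣ) : Mat N) * (1 + (B : Mat N)))})
      (ContDiff.contDiffOn ?_) (fun B hB => hB)
    exact contDiff_const.mul (contDiff_const.add (Nil t).subtypeL.contDiff)
  have key : ∀ B : Nil t, FlagMfd.ofGL t (g * unip t B) ∈ (flagChart (t := t) h).source →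
      BigCell t.P (m + 1) (((h⁻¹ * g : (Mat N)ˣ) : Mat N) * (1 + (B : Mat N))) ∧
      flagChart h (FlagMfd.ofGL t (g * unip t B)) = nilProj t (lowerFactor t.P (m + 1)
      (((h⁻¹ * g : (Mat N)ˣ) : Mat N) * (1 + (B : Mat N))) - 1) := by
    intro B hB
    have := flagChart_ofGL hB
    rwa [← mul_assoc, Units.val_mul, unip_val] at this
  refine (h1.mono ?_).congr ?_
  · rintro B ⟨⟨_, hB⟩, _⟩
    exact (key B hB).1
  · rintro B ⟨⟨_, hB⟩, _⟩
    exact (key B hB).2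

/-! ### Holomorphic vector bundles from holomorphic frames -/

section Builder

variable {E H M : Type*} [NormedAddCommGroup E] [NormedSpace ℂ E] [TopologicalSpace H]
  (I : ModelWithCorners ℂ E H) [TopologicalSpace M] [ChartedSpace H M]
  (F : Type*) [NormedAddCommGroup F] [NormedSpace ℂ F]
  (W : M → Type*) [∀ p, AddCommGroup (W p)] [∀ p, Module ℂ (W p)] [∀ p, TopologicalSpace (W p)]

/-- Local linear trivializations of a family of complex vector spaces, with holomorphic
transition functions. -/
structure FrameAtlas where
  ι : Type
  base : ι → Set M
  isOpen_base : ∀ a, IsOpen (base a)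
  triv : ∀ a p, p ∈ base a → W p ≃ₗ[ℂ] F
  indexAt : M → ι
  mem_base : ∀ p, p ∈ base (indexAt p)
  holomorphic : ∀ a b (c : F), ∃ f : M → F, ContMDiffOn I 𝓘(ℂ, F) ω f (base a ∩ base b) ∧
    ∀ p (ha : p ∈ base a) (hb : p ∈ base b), f p = triv b p hb ((triv a p ha).symm c)
  isInducing : ∀ a p (h : p ∈ base a), Topology.IsInducing (triv a p h)

variable {I F W}

/-- A family of operators on a finite-dimensional space is holomorphic if it is so pointwise. -/
lemma contMDiffOn_clm_of_apply [FiniteDimensional ℂ F] {f : M → F →L[ℂ] F} {s : Set M}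
    (h : ∀ c, ContMDiffOn I 𝓘(ℂ, F) ω (fun p => f p c) s) :
    ContMDiffOn I 𝓘(ℂ, F →L[ℂ] F) ω f s := by
  let b := Module.finBasis ℂ F
  have e : f = fun p => ∑ i, ContinuousLinearMap.smulRightL ℂ F F
      (LinearMap.toContinuousLinearMap (b.coord i)) (f p (b i)) := by
    funext p
    ext1 c
    conv_lhs => rw [← b.sum_repr c, map_sum]
    simp
  rw [e]
  refine contMDiffOn_finsetSum fun i _ => ?_
  exact (ContinuousLinearMap.contDiff _).contMDiff.comp_contMDiffOn (h (b i))

namespace FrameAtlas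

variable (A : FrameAtlas I F W)

open Classical in
/-- The local trivialization of the total space. -/
def pretriv (a : A.ι) : Pretrivialization F (π F W) where
  toFun x := (x.1, if h : x.1 ∈ A.base a then A.triv a x.1 h x.2 else 0)
  invFun y := ⟨y.1, if h : y.1 ∈ A.base a then (A.triv a y.1 h).symm y.2 else 0⟩
  source := π F W ⁻¹' A.base a
  target := A.base a ×ˢ univ
  map_source' x hx := ⟨hx, mem_univ _⟩
  map_target' y hy := hy.1
  left_inv' := by
    rintro ⟨p, w⟩ hp
    have hp' : p ∈ A.base a := hp
    simp [hp']
  right_inv' := by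
    rintro ⟨p, c⟩ ⟨hp, -⟩
    have hp' : p ∈ A.base a := hp
    simp [hp']
  open_target := (A.isOpen_base a).prod isOpen_univ
  baseSet := A.base a
  open_baseSet := A.isOpen_base a
  source_eq := rfl
  target_eq := rfl
  proj_toFun _ _ := rfl

open Classical in
lemma pretriv_apply (a : A.ι) {p : M} (h : p ∈ A.base a) (w : W p) :
    A.pretriv a ⟨p, w⟩ = (p, A.triv a p h w) := by
  change (p, dite _ _ _) = _
  rw [dif_pos h]

open Classical in
lemma pretriv_symm (a : A.ι) {p : M} (h : p ∈ A.base a) (c : F) :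
    (A.pretriv a).symm p c = (A.triv a p h).symm c := by
  have h1 := (A.pretriv a).mk_symm (b := p) h c
  have h2 : (A.pretriv a).toPartialEquiv.symm (p, c) = ⟨p, (A.triv a p h).symm c⟩ := by
    change (⟨p, dite _ _ _⟩ : TotalSpace F W) = _
    rw [dif_pos h]
  rw [h2] at h1
  exact eq_of_heq (TotalSpace.mk.inj h1).2

lemma pretriv_isLinear (a : A.ι) : (A.pretriv a).IsLinear ℂ where
  linear p hp := by
    have hp' : p ∈ A.base a := hp
    constructor
    · intro x y; simp [A.pretriv_apply a hp']
    · intro c x; simp [A.pretriv_apply a hp']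

variable [FiniteDimensional ℂ F]

open Classical in
lemma exists_change (a b : A.ι) : ∃ f : M → F →L[ℂ] F,
    ContMDiffOn I 𝓘(ℂ, F →L[ℂ] F) ω f ((A.pretriv a).baseSet ∩ (A.pretriv b).baseSet) ∧
    ∀ p ∈ (A.pretriv a).baseSet ∩ (A.pretriv b).baseSet, ∀ c : F,
      f p c = (A.pretriv b ⟨p, (A.pretriv a).symm p c⟩).2 := by
  refine ⟨fun p => if h : p ∈ A.base a ∩ A.base b then LinearMap.toContinuousLinearMap
    ((A.triv a p h.1).symm.trans (A.triv b p h.2)).toLinearMap else 0, ?_, ?_⟩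
  · refine contMDiffOn_clm_of_apply fun c => ?_
    obtain ⟨f, hf, hf'⟩ := A.holomorphic a b c
    refine hf.congr fun p hp => ?_
    have hp' : p ∈ A.base a ∩ A.base b := hp
    simp [hf' p hp.1 hp.2, hp'.1, hp'.2]
  · intro p hp c
    rw [A.pretriv_symm a hp.1, A.pretriv_apply b hp.2]
    have hp' : p ∈ A.base a ∩ A.base b := hp
    simp [hp'.1, hp'.2]

/-- The vector bundle structure defined by a holomorphic frame atlas. -/
def prebundle : VectorPrebundle ℂ F W where
  pretrivializationAtlas := Set.range A.pretriv
  pretrivialization_linear' := by rintro _ ⟨a, rfl⟩; exact A.pretriv_isLinear a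
  pretrivializationAt p := A.pretriv (A.indexAt p)
  mem_base_pretrivializationAt := A.mem_base
  pretrivialization_mem_atlas p := ⟨_, rfl⟩
  exists_coordChange := by
    rintro _ ⟨a, rfl⟩ _ ⟨b, rfl⟩
    obtain ⟨f, hf, hf'⟩ := A.exists_change a b
    exact ⟨f, hf.continuousOn, hf'⟩
  totalSpaceMk_isInducing p := by
    have h : p ∈ A.base (A.indexAt p) := A.mem_base p
    have e : A.pretriv (A.indexAt p) ∘ TotalSpace.mk p
        = fun w => (p, A.triv _ p h w) := funext fun w => A.pretriv_apply _ h w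
    rw [e]
    exact (Topology.isInducing_const_prod (x := p)).2 (A.isInducing _ p h)

instance : A.prebundle.IsContMDiff I ω where
  exists_contMDiffCoordChange := by
    rintro _ ⟨a, rfl⟩ _ ⟨b, rfl⟩
    exact A.exists_change a b

end FrameAtlas

end Builder

/-! ### The tautological bundles -/

variable (t) in
/-- The reference flag. -/
def FlagMfd.ref : FlagMfd t := ⟨t.refSub, t.refSub_mono, t.finrank_refSub⟩

/-- `x` maps every member of the flag `F` onto the corresponding member of `F'`. -/
def Carries (x : (Mat N)ˣ) (F F' : FlagMfd t) : Prop :=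
  ∀ j v, v ∈ F.V j ↔ (x : Mat N) v ∈ F'.V j

lemma Carries.inv {x : (Mat N)ˣ} {F F' : FlagMfd t} (h : Carries x F F') : Carries x⁻¹ F' F :=
  fun j v => by rw [h j, apply_inv_apply]

lemma Carries.mul {x y : (Mat N)ˣ} {F F' F'' : FlagMfd t} (h : Carries x F' F'')
    (h' : Carries y F F') : Carries (x * y) F F'' :=
  fun j v => by rw [h' j, h j, Units.val_mul, mat_mul_apply]

/-- The invertible matrix `g (1 + B)`, where `B` is the coordinate of the flag `F` in the chart
given by `g`; it is a holomorphic function of `F` and maps the reference flag to `F`. -/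
def moving (g : (Mat N)ˣ) (F : FlagMfd t) : (Mat N)ˣ := g * unip t (flagChart g F)

lemma carries_ofGL {x : (Mat N)ˣ} {F : FlagMfd t} (e : FlagMfd.ofGL t x = F) :
    Carries x (FlagMfd.ref t) F := by
  subst e
  intro j v
  constructor
  · intro hv; exact ⟨v, hv, rfl⟩
  · rintro ⟨w, hw, hw'⟩
    have hw'' : (x : Mat N) w = (x : Mat N) v := hw'
    have : w = v := by rw [← inv_apply_apply x w, hw'', inv_apply_apply]
    rwa [← this]

lemma carries_moving {g : (Mat N)ˣ} {F : FlagMfd t} (h : F ∈ (flagChart (t := t) g).source) :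
    Carries (moving g F) (FlagMfd.ref t) F :=
  carries_ofGL ((flagChart g).left_inv h)

lemma contMDiffOn_moving (g : (Mat N)ˣ) :
    ContMDiffOn 𝓘(ℂ, Nil t) 𝓘(ℂ, Mat N) ω (fun F : FlagMfd t => (moving g F : Mat N))
      (flagChart (t := t) g).source := by
  have h1 : ContMDiffOn 𝓘(ℂ, Nil t) 𝓘(ℂ, Nil t) ω (flagChart (t := t) g)
      (flagChart (t := t) g).source :=
    contMDiffOn_of_mem_maximalAtlas (IsManifold.subset_maximalAtlas ⟨g, rfl⟩)
  have h2 : ContDiff ℂ ω (fun B : Nil t => (g : Mat N) * (1 + (B : Mat N))) :=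
    contDiff_const.mul (contDiff_const.add (Nil t).subtypeL.contDiff)
  exact h2.contMDiff.comp_contMDiffOn h1

lemma contMDiffOn_moving_inv (g : (Mat N)ˣ) :
    ContMDiffOn 𝓘(ℂ, Nil t) 𝓘(ℂ, Mat N) ω (fun F : FlagMfd t => ((moving g F)⁻¹.val : Mat N))
      (flagChart (t := t) g).source := by
  have h1 : (fun F : FlagMfd t => ((moving g F)⁻¹.val : Mat N))
      = fun F => Ring.inverse (moving g F : Mat N) := funext fun F => (Ring.inverse_unit _).symm
  rw [h1]
  intro F hF
  have h2 : ContMDiffAt 𝓘(ℂ, Mat N) 𝓘(ℂ, Mat N) ω (Ring.inverse : Mat N → Mat N)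
      (moving g F : Mat N) := (contDiffAt_ringInverse ℂ (moving g F)).contMDiffAt
  exact h2.comp_contMDiffWithinAt F (contMDiffOn_moving g F hF)

variable (t) in
/-- The model fibre of the tautological bundle `H_i`. -/
abbrev TautModel (i : Fin (m + 1)) : Type := t.refSub i

variable (t) in
/-- The tautological bundle `H_i` on the flag manifold: its fibre over a flag is the `i`-th
member of the flag. -/
def Taut (i : Fin (m + 1)) (F : FlagMfd t) : Type := F.V i

section TautInstances

variable (i : Fin (m + 1)) (F : FlagMfd t)

instance : NormedAddCommGroup (TautModel t i) := Submodule.normedAddCommGroup (t.refSub i)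
instance : NormedSpace ℂ (TautModel t i) := Submodule.normedSpace (t.refSub i)
instance : FiniteDimensional ℂ (TautModel t i) :=
  FiniteDimensional.finiteDimensional_submodule (t.refSub i)

instance : NormedAddCommGroup (Taut t i F) := Submodule.normedAddCommGroup (F.V i)
instance : NormedSpace ℂ (Taut t i F) := Submodule.normedSpace (F.V i)
instance : FiniteDimensional ℂ (Taut t i F) :=
  FiniteDimensional.finiteDimensional_submodule (F.V i)

end TautInstances

/-- The identification of the fibre of `H_i` over `F` with the model fibre. -/
def tautEquiv (i : Fin (m + 1)) {x : (Mat N)ˣ} {F : FlagMfd t} (h : Carries x (FlagMfd.ref t) F) :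
    Taut t i F ≃ₗ[ℂ] TautModel t i where
  toFun v := ⟨(x⁻¹).val v.1, (h.inv i v.1).1 v.2⟩
  invFun v := ⟨(x : Mat N) v.1, (h i v.1).1 v.2⟩
  map_add' v w := Subtype.ext (map_add (x⁻¹).val v.1 w.1)
  map_smul' c v := Subtype.ext (map_smul (x⁻¹).val c v.1)
  left_inv v := Subtype.ext (apply_inv_apply x v.1)
  right_inv v := Subtype.ext (inv_apply_apply x v.1)

variable (t) in
/-- Holomorphic frames of `H_i` over the charts of the flag manifold. -/
def tautAtlas (i : Fin (m + 1)) : FrameAtlas 𝓘(ℂ, Nil t) (TautModel t i) (Taut t i) where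
  ι := (Mat N)ˣ
  base g := (flagChart (t := t) g).source
  isOpen_base g := (flagChart g).open_source
  triv g F h := tautEquiv i (carries_moving h)
  indexAt := FlagMfd.rep
  mem_base := mem_flagChart_rep
  holomorphic g h c := by
    obtain ⟨ρ, hρ⟩ := exists_proj (t.refSub i)
    refine ⟨fun F => ρ ((moving h F)⁻¹.val ((moving g F).val c.1)), ?_, ?_⟩
    · have h1 := (contMDiffOn_moving_inv (t := t) h).mono
        (Set.inter_subset_right (s := (flagChart (t := t) g).source))
      have h2 := (contMDiffOn_moving (t := t) g).mono
        (Set.inter_subset_left (t := (flagChart (t := t) h).source))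
      have h3 := h1.clm_apply (h2.clm_apply (contMDiffOn_const (c := c.1)))
      exact ρ.contDiff.contMDiff.comp_contMDiffOn h3
    · intro F ha hb
      exact hρ (tautEquiv i (carries_moving hb) ((tautEquiv i (carries_moving ha)).symm c))
  isInducing g F h :=
    (tautEquiv i (carries_moving h)).toContinuousLinearEquiv.toHomeomorph.isInducing

instance (i : Fin (m + 1)) : TopologicalSpace (TotalSpace (TautModel t i) (Taut t i)) :=
  (tautAtlas t i).prebundle.totalSpaceTopology

instance (i : Fin (m + 1)) : FiberBundle (TautModel t i) (Taut t i) :=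
  (tautAtlas t i).prebundle.toFiberBundle

instance (i : Fin (m + 1)) : VectorBundle ℂ (TautModel t i) (Taut t i) :=
  (tautAtlas t i).prebundle.toVectorBundle

instance (i : Fin (m + 1)) : ContMDiffVectorBundle ω (TautModel t i) (Taut t i) 𝓘(ℂ, Nil t) :=
  (tautAtlas t i).prebundle.contMDiffVectorBundle 𝓘(ℂ, Nil t)

/-! ### The bundle `E` on `X × X` -/

lemma FlagMfd.V_mono_of_succ (F : FlagMfd t) {j j' : Fin m} (h : j'.val = j.val + 1) :
    F.V j.castSucc ≤ F.V j'.castSucc :=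
  F.mono (Fin.le_def.2 (by simp [h]))

/-- The fibre at `(z, ζ)` of the direct sum of the bundles
`Hom(H_{j,ζ}, F_{j,z}) = F_{j,z} ⊗ H_{j,ζ}^*`, where `F_j = ℂ^N / H_j` and `j` runs over all
indices but the last. -/
abbrev HomSum (z ζ : FlagMfd t) : Type :=
  (j : Fin m) → ζ.V j.castSucc →ₗ[ℂ] (Vec N ⧸ z.V j.castSucc)

/-- The fibre of `E = ker Φ` at `(z, ζ)`, where
`Φ (∑ f_j) = ∑ (f_{j+1}|_{H_{j,ζ}} - Q_j ∘ f_j)` and `Q_j : F_j → F_{j+1}` is the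
natural quotient map. -/
def diagFiber (z ζ : FlagMfd t) : Submodule ℂ (HomSum z ζ) where
  carrier := {f | ∀ (j j' : Fin m) (h : j'.val = j.val + 1) (v : ζ.V j.castSucc),
    f j' (Submodule.inclusion (ζ.V_mono_of_succ h) v)
      = Submodule.factor (z.V_mono_of_succ h) (f j v)}
  add_mem' {f g} hf hg j j' h v := by
    simp only [Pi.add_apply, LinearMap.add_apply, hf j j' h v, hg j j' h v, map_add]
  zero_mem' j j' h v := by simp
  smul_mem' c f hf j j' h v := by
    simp only [Pi.smul_apply, LinearMap.smul_apply, hf j j' h v, map_smul]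

instance (z ζ : FlagMfd t) : FiniteDimensional ℂ (HomSum z ζ) :=
  have : ∀ j : Fin m, Module.Finite ℂ (ζ.V j.castSucc →ₗ[ℂ] (Vec N ⧸ z.V j.castSucc)) :=
    fun _ => Module.Finite.linearMap ℂ ℂ _ _
  Module.Finite.pi

instance (z ζ : FlagMfd t) : FiniteDimensional ℂ (diagFiber z ζ) :=
  FiniteDimensional.finiteDimensional_submodule _

instance (z ζ : FlagMfd t) : Module.Free ℂ (diagFiber z ζ) := Module.Free.of_divisionRing ℂ (diagFiber z ζ)

/-- The linear map `f ↦ x ∘ f ∘ y⁻¹` between fibres of `E`. -/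
def diagMap {x y : (Mat N)ˣ} {z z' ζ ζ' : FlagMfd t} (hx : Carries x z z') (hy : Carries y ζ ζ') :
    diagFiber z ζ →ₗ[ℂ] diagFiber z' ζ' where
  toFun f := ⟨fun j =>
      ((z.V j.castSucc).mapQ (z'.V j.castSucc) (x.val : Vec N →ₗ[ℂ] Vec N)
        (fun v hv => (hx j.castSucc v).1 hv)).comp
      ((f.1 j).comp (LinearMap.restrict (y⁻¹.val : Vec N →ₗ[ℂ] Vec N)
        (fun v hv => (hy.inv j.castSucc v).1 hv))), by
    intro j j' h v
    have h1 := f.2 j j' h (LinearMap.restrict (y⁻¹.val : Vec N →ₗ[ℂ] Vec N)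
        (fun v hv => (hy.inv j.castSucc v).1 hv) v)
    obtain ⟨w, hw⟩ := Submodule.mkQ_surjective _ (f.1 j (LinearMap.restrict
      (y⁻¹.val : Vec N →ₗ[ℂ] Vec N) (fun v hv => (hy.inv j.castSucc v).1 hv) v))
    rw [← hw] at h1
    simp only [LinearMap.comp_apply]
    rw [← hw]
    refine (congrArg _ h1).trans ?_
    rfl⟩
  map_add' f g := by
    refine Subtype.ext (funext fun j => LinearMap.ext fun v => ?_)
    simp
  map_smul' c f := by
    refine Subtype.ext (funext fun j => LinearMap.ext fun v => ?_)
    simp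

lemma diagMap_apply {x y : (Mat N)ˣ} {z z' ζ ζ' : FlagMfd t} (hx : Carries x z z')
    (hy : Carries y ζ ζ') (f : diagFiber z ζ) (j : Fin m) (v : ζ'.V j.castSucc) :
    (diagMap hx hy f).1 j v = (z.V j.castSucc).mapQ (z'.V j.castSucc)
      (x.val : Vec N →ₗ[ℂ] Vec N) (fun v hv => (hx j.castSucc v).1 hv)
      (f.1 j ⟨y⁻¹.val v.1, (hy.inv j.castSucc v.1).1 v.2⟩) := rfl

lemma diagMap_diagMap {x y x' y' : (Mat N)ˣ} {z z' ζ ζ' : FlagMfd t} (hx : Carries x z z')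
    (hy : Carries y ζ ζ') (hx' : Carries x' z' z) (hy' : Carries y' ζ' ζ)
    (ex : x' * x = 1) (ey : y' * y = 1) (f : diagFiber z ζ) :
    diagMap hx' hy' (diagMap hx hy f) = f := by
  refine Subtype.ext (funext fun j => LinearMap.ext fun v => ?_)
  rw [diagMap_apply, diagMap_apply]
  have e1 : (⟨y⁻¹.val (y'⁻¹.val v.1), (hy.inv j.castSucc _).1 ((hy'.inv j.castSucc v.1).1 v.2)⟩ :
      ζ.V j.castSucc) = v := by
    refine Subtype.ext ?_
    change y⁻¹.val (y'⁻¹.val v.1) = v.1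
    rw [← mat_mul_apply, ← Units.val_mul, ← mul_inv_rev, ey, inv_one]; rfl
  rw [e1]
  obtain ⟨w, hw⟩ := Submodule.mkQ_surjective _ (f.1 j v)
  rw [← hw]
  change (z.V j.castSucc).mkQ (x'.val (x.val w)) = _
  rw [← mat_mul_apply, ← Units.val_mul, ex]; rfl

/-- The isomorphism `f ↦ x ∘ f ∘ y⁻¹` between fibres of `E`. -/
def diagEquiv {x y : (Mat N)ˣ} {z z' ζ ζ' : FlagMfd t} (hx : Carries x z z') (hy : Carries y ζ ζ') :
    diagFiber z ζ ≃ₗ[ℂ] diagFiber z' ζ' where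
  __ := diagMap hx hy
  invFun := diagMap hx.inv hy.inv
  left_inv f := diagMap_diagMap hx hy hx.inv hy.inv (inv_mul_cancel x) (inv_mul_cancel y) f
  right_inv f := diagMap_diagMap hx.inv hy.inv hx hy (mul_inv_cancel x) (mul_inv_cancel y) f

variable (t) in
/-- The bundle `E` on `X × X`. -/
def DiagBundle (p : FlagMfd t × FlagMfd t) : Type := diagFiber p.1 p.2

instance (p : FlagMfd t × FlagMfd t) : AddCommGroup (DiagBundle t p) :=
  inferInstanceAs (AddCommGroup (diagFiber p.1 p.2))

instance (p : FlagMfd t × FlagMfd t) : Module ℂ (DiagBundle t p) :=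
  inferInstanceAs (Module ℂ (diagFiber p.1 p.2))

instance (p : FlagMfd t × FlagMfd t) : TopologicalSpace (DiagBundle t p) := moduleTopology ℂ _

instance (p : FlagMfd t × FlagMfd t) : IsModuleTopology ℂ (DiagBundle t p) := ⟨rfl⟩

variable (t) in
/-- The model fibre of `E`. -/
abbrev DiagModel : Type := Fin (Module.finrank ℂ (diagFiber (FlagMfd.ref t) (FlagMfd.ref t))) → ℂ

/-- The identification of the fibre of `E` with the model fibre. -/
def diagTriv {x y : (Mat N)ˣ} {p : FlagMfd t × FlagMfd t} (hx : Carries x (FlagMfd.ref t) p.1)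
    (hy : Carries y (FlagMfd.ref t) p.2) : DiagBundle t p ≃ₗ[ℂ] DiagModel t :=
  (diagEquiv hx hy).symm.trans
    (Module.finBasis ℂ (diagFiber (FlagMfd.ref t) (FlagMfd.ref t))).equivFun

lemma exists_diag_coord : ∃ L : (Fin m → Mat N) →ₗ[ℂ] DiagModel t,
    ∀ (φ : Fin m → Mat N) (f : diagFiber (FlagMfd.ref t) (FlagMfd.ref t)),
      (∀ j v, f.1 j v = (t.refSub j.castSucc).mkQ (φ j v.1)) →
      L φ = (Module.finBasis ℂ (diagFiber (FlagMfd.ref t) (FlagMfd.ref t))).equivFun f := by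
  obtain ⟨K, hK⟩ := LinearMap.exists_extend
    (Module.finBasis ℂ (diagFiber (FlagMfd.ref t) (FlagMfd.ref t))).equivFun.toLinearMap
  let R : (Fin m → Mat N) →ₗ[ℂ] HomSum (FlagMfd.ref t) (FlagMfd.ref t) :=
    { toFun := fun φ j => ((t.refSub j.castSucc).mkQ.comp (φ j : Vec N →ₗ[ℂ] Vec N)).comp
        (t.refSub j.castSucc).subtype
      map_add' := fun φ ψ => by
        funext j; exact LinearMap.ext fun v => map_add (t.refSub j.castSucc).mkQ (φ j v.1) (ψ j v.1)
      map_smul' := fun c φ => by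
        funext j; exact LinearMap.ext fun v => map_smul (t.refSub j.castSucc).mkQ c (φ j v.1) }
  refine ⟨K.comp R, fun φ f h => ?_⟩
  have e : R φ = f.1 := by
    funext j
    exact LinearMap.ext fun v => (h j v).symm
  rw [LinearMap.comp_apply, e]
  exact LinearMap.congr_fun hK f

lemma exists_diag_lift (f : diagFiber (FlagMfd.ref t) (FlagMfd.ref t)) : ∃ φ : Fin m → Mat N,
    ∀ j v, f.1 j v = (t.refSub j.castSucc).mkQ (φ j v.1) := by
  have : ∀ j : Fin m, ∃ φ : Mat N, ∀ v, f.1 j v = (t.refSub j.castSucc).mkQ (φ v.1) := by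
    intro j
    obtain ⟨ρ, hρ⟩ := exists_proj (t.refSub j.castSucc)
    obtain ⟨s, hs⟩ := LinearMap.exists_rightInverse_of_surjective (t.refSub j.castSucc).mkQ
      (LinearMap.range_eq_top.2 (Submodule.mkQ_surjective _))
    refine ⟨LinearMap.toContinuousLinearMap (s.comp ((f.1 j).comp ρ.toLinearMap)), ?_⟩
    intro v
    have := LinearMap.congr_fun hs (f.1 j (ρ v.1))
    have h2 : ρ v.1 = v := hρ v
    rw [h2] at this
    refine this.symm.trans ?_
    change _ = (t.refSub j.castSucc).mkQ (s (f.1 j (ρ v.1)))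
    rw [h2]; rfl
  choose φ hφ using this
  exact ⟨φ, hφ⟩

variable (t) in
/-- Holomorphic frames of `E` over products of charts. -/
def diagAtlas : FrameAtlas (𝓘(ℂ, Nil t).prod 𝓘(ℂ, Nil t)) (DiagModel t) (DiagBundle t) where
  ι := (Mat N)ˣ × (Mat N)ˣ
  base a := (flagChart (t := t) a.1).source ×ˢ (flagChart (t := t) a.2).source
  isOpen_base a := (flagChart a.1).open_source.prod (flagChart a.2).open_source
  triv a p h := diagTriv (carries_moving h.1) (carries_moving h.2)
  indexAt p := (p.1.rep, p.2.rep)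
  mem_base p := ⟨mem_flagChart_rep p.1, mem_flagChart_rep p.2⟩
  holomorphic a b c := by
    obtain ⟨L, hL⟩ := exists_diag_coord (t := t)
    let f0 := (Module.finBasis ℂ (diagFiber (FlagMfd.ref t) (FlagMfd.ref t))).equivFun.symm c
    obtain ⟨φ, hφ⟩ := exists_diag_lift f0
    refine ⟨fun p => LinearMap.toContinuousLinearMap L fun j =>
      ((moving b.1 p.1)⁻¹.val * (moving a.1 p.1).val) * φ j *
        ((moving a.2 p.2)⁻¹.val * (moving b.2 p.2).val), ?_, ?_⟩
    · have hl : ContMDiffOn (𝓘(ℂ, Nil t).prod 𝓘(ℂ, Nil t)) 𝓘(ℂ, Fin m → Mat N) ω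
          (fun (p : FlagMfd t × FlagMfd t) j => ((moving b.1 p.1)⁻¹.val * (moving a.1 p.1).val) * φ j *
            ((moving a.2 p.2)⁻¹.val * (moving b.2 p.2).val))
          ((flagChart (t := t) a.1).source ×ˢ (flagChart (t := t) a.2).source ∩
            (flagChart (t := t) b.1).source ×ˢ (flagChart (t := t) b.2).source) := by
        refine contMDiffOn_pi_space.2 fun j => ?_
        have e1 := (contMDiffOn_moving_inv (t := t) b.1).comp (contMDiffOn_fst (s :=
          (flagChart (t := t) a.1).source ×ˢ (flagChart (t := t) a.2).source ∩
            (flagChart (t := t) b.1).source ×ˢ (flagChart (t := t) b.2).source)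
          (I := 𝓘(ℂ, Nil t)) (J := 𝓘(ℂ, Nil t))) (fun p hp => hp.2.1)
        have e2 := (contMDiffOn_moving (t := t) a.1).comp (contMDiffOn_fst (s :=
          (flagChart (t := t) a.1).source ×ˢ (flagChart (t := t) a.2).source ∩
            (flagChart (t := t) b.1).source ×ˢ (flagChart (t := t) b.2).source)
          (I := 𝓘(ℂ, Nil t)) (J := 𝓘(ℂ, Nil t))) (fun p hp => hp.1.1)
        have e3 := (contMDiffOn_moving_inv (t := t) a.2).comp (contMDiffOn_snd (s :=
          (flagChart (t := t) a.1).source ×ˢ (flagChart (t := t) a.2).source ∩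
            (flagChart (t := t) b.1).source ×ˢ (flagChart (t := t) b.2).source)
          (I := 𝓘(ℂ, Nil t)) (J := 𝓘(ℂ, Nil t))) (fun p hp => hp.1.2)
        have e4 := (contMDiffOn_moving (t := t) b.2).comp (contMDiffOn_snd (s :=
          (flagChart (t := t) a.1).source ×ˢ (flagChart (t := t) a.2).source ∩
            (flagChart (t := t) b.1).source ×ˢ (flagChart (t := t) b.2).source)
          (I := 𝓘(ℂ, Nil t)) (J := 𝓘(ℂ, Nil t))) (fun p hp => hp.2.2)
        have e5 : ContMDiffOn (𝓘(ℂ, Nil t).prod 𝓘(ℂ, Nil t)) 𝓘(ℂ, Mat N) ω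
          (fun _ : FlagMfd t × FlagMfd t => φ j) ((flagChart (t := t) a.1).source ×ˢ
            (flagChart (t := t) a.2).source ∩
            (flagChart (t := t) b.1).source ×ˢ (flagChart (t := t) b.2).source) :=
          contMDiffOn_const
        exact ((e1.clm_comp e2).clm_comp e5).clm_comp (e3.clm_comp e4)
      exact (LinearMap.toContinuousLinearMap L).contDiff.contMDiff.comp_contMDiffOn hl
    · intro p ha hb
      refine hL _ ((diagEquiv (carries_moving hb.1) (carries_moving hb.2)).symm
        (diagEquiv (carries_moving ha.1) (carries_moving ha.2) f0)) fun j v => ?_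
      change (diagMap (carries_moving hb.1).inv (carries_moving hb.2).inv
        (diagMap (carries_moving ha.1) (carries_moving ha.2) f0)).1 j v = _
      rw [diagMap_apply, diagMap_apply, hφ]
      rfl
  isInducing a p h := by
    let e := diagTriv (carries_moving h.1) (carries_moving h.2)
    have : ContinuousAdd (DiagBundle t p) := IsModuleTopology.toContinuousAdd ℂ _
    have : ContinuousSMul ℂ (DiagBundle t p) := IsModuleTopology.toContinuousSMul ℂ _
    have h1 : Continuous e := IsModuleTopology.continuous_of_linearMap e.toLinearMap
    have h2 : Continuous e.symm := IsModuleTopology.continuous_of_linearMap e.symm.toLinearMap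
    exact (Homeomorph.mk e.toEquiv h1 h2).isInducing

instance : TopologicalSpace (TotalSpace (DiagModel t) (DiagBundle t)) :=
  (diagAtlas t).prebundle.totalSpaceTopology

instance : FiberBundle (DiagModel t) (DiagBundle t) := (diagAtlas t).prebundle.toFiberBundle

instance : VectorBundle ℂ (DiagModel t) (DiagBundle t) := (diagAtlas t).prebundle.toVectorBundle

instance : ContMDiffVectorBundle ω (DiagModel t) (DiagBundle t)
    (𝓘(ℂ, Nil t).prod 𝓘(ℂ, Nil t)) :=
  (diagAtlas t).prebundle.contMDiffVectorBundle (𝓘(ℂ, Nil t).prod 𝓘(ℂ, Nil t))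

/-! ### Weights -/

/-- The directional `∂̄`-derivative `½ (Df(x) τ + i Df(x) (i τ))` of a function between complex
vector spaces. -/
def dbarVec {E F : Type*} [NormedAddCommGroup E] [NormedSpace ℂ E] [NormedAddCommGroup F]
    [NormedSpace ℂ F] (f : E → F) (x τ : E) : F :=
  (1 / 2 : ℂ) • (fderiv ℝ f x τ + Complex.I • fderiv ℝ f x (Complex.I • τ))

section Weights

variable {E H X : Type*} [NormedAddCommGroup E] [NormedSpace ℂ E] [TopologicalSpace H]
  (I : ModelWithCorners ℂ E H) [TopologicalSpace X] [ChartedSpace H X] [IsManifold I ω X]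
  (FV : Type*) [NormedAddCommGroup FV] [NormedSpace ℂ FV]
  (V : X → Type*) [∀ z, AddCommGroup (V z)] [∀ z, Module ℂ (V z)] [∀ z, TopologicalSpace (V z)]
  [TopologicalSpace (TotalSpace FV V)] [FiberBundle FV V] [VectorBundle ℂ FV V]
  (FW : Type*) [NormedAddCommGroup FW] [NormedSpace ℂ FW]
  (W : X × X → Type*) [∀ p, AddCommGroup (W p)] [∀ p, Module ℂ (W p)]
  [∀ p, TopologicalSpace (W p)]
  [TopologicalSpace (TotalSpace FW W)] [FiberBundle FW W] [VectorBundle ℂ FW W]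

/-- Functions with the arguments of a section `g` of
`Hom(V_ζ, V_z) ⊗ Λ^k W^* ∧ T^*_{0,q}(X × X)`: the value at a point `p = (z, ζ)`, on `k` vectors
of `W_p`, `q` tangent vectors at `p` and a vector of `V_ζ`, is a vector of `V_z`. In the wedge
product the factors in `W^*` stand before those in `T^*_{0,q}`. -/
abbrev PreForm (k q : ℕ) : Type _ :=
  ∀ p : X × X, (Fin k → W p) → (Fin q → TangentSpace (I.prod I) p) → V p.2 → V p.1

variable {I V W}

/-- The coefficient of `g` on constant vectors with respect to the holomorphic chart of `X × X`
and the holomorphic trivializations of `V` and `W` centred at `p₀ = (z₀, ζ₀)`. -/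
def PreForm.coeff {k q : ℕ} (g : PreForm I V W k q) (p₀ : X × X) (e : Fin k → FW)
    (τ : Fin q → E × E) (v : FV) (x : E × E) : FV :=
  let p : X × X := (extChartAt (I.prod I) p₀).symm x
  (trivializationAt FV V p₀.1).continuousLinearMapAt ℂ p.1
    (g p (fun j => (trivializationAt FW W p₀).symmL ℂ p (e j))
      (fun j => tangentCoordChange (I.prod I) p₀ p p (τ j))
      ((trivializationAt FV V p₀.2).symmL ℂ p.2 v))

/-- `g` is a smooth section of `Hom(V_ζ, V_z) ⊗ Λ^k W^* ∧ T^*_{0,q}(X × X)`: pointwise it is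
alternating and complex multilinear on `W`, alternating and conjugate-multilinear on tangent
vectors, linear on `V_ζ`; and its local coefficients are smooth. -/
structure PreForm.IsSmooth {k q : ℕ} (g : PreForm I V W k q) : Prop where
  multilinear : ∀ p : X × X, ∃ φ : (W p) [⋀^Fin k]→ₗ[ℂ]
      ((TangentSpace (I.prod I) p) [⋀^Fin q]→ₗ[ℝ] (V p.2 →ₗ[ℂ] V p.1)),
    ∀ e τ v, g p e τ v = φ e τ v
  conj_smul : ∀ (p : X × X) (e : Fin k → W p) (τ : Fin q → TangentSpace (I.prod I) p)
    (v : V p.2) (l : Fin q),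
    g p e (Function.update τ l (Complex.I • τ l)) v = -Complex.I • g p e τ v
  contDiffAt : ∀ (p₀ : X × X) (e : Fin k → FW) (τ : Fin q → E × E) (v : FV),
    ContDiffAt ℝ ∞ (g.coeff FV FW p₀ e τ v) (extChartAt (I.prod I) p₀ p₀)

/-- The operator `∂̄` on sections of `Hom(V_ζ, V_z) ⊗ Λ^k W^* ∧ T^*_{0,q}(X × X)`, computed in
holomorphic coordinates and holomorphic frames centred at the point. The sign `(-1)^k` comes from
moving `∂̄` past the factor in `Λ^k W^*`. -/
def PreForm.dbar {k q : ℕ} (g : PreForm I V W k q) : PreForm I V W k (q + 1) :=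
  fun p e τ v =>
    (-1 : ℂ) ^ k • ∑ l : Fin (q + 1), (-1 : ℂ) ^ l.val •
      (trivializationAt FV V p.1).symmL ℂ p.1
        (dbarVec
          (g.coeff FV FW p (fun j => (trivializationAt FW W p).continuousLinearMapAt ℂ p (e j))
            (fun j => τ (l.succAbove j))
            ((trivializationAt FV V p.2).continuousLinearMapAt ℂ p.2 v))
          (extChartAt (I.prod I) p p) (τ l))

/-- Interior multiplication by a section `η` of `W`. -/
def PreForm.contract (η : ∀ p, W p) {k q : ℕ} (g : PreForm I V W (k + 1) q) :
    PreForm I V W k q :=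
  fun p e τ v => g p (Matrix.vecCons (η p) e) τ v

/-- The operator `∇_η = δ_η - ∂̄` on bigraded families `g = ∑ g_{k,q}` of sections of
`Hom(V_ζ, V_z) ⊗ Λ^k W^* ∧ T^*_{0,q}(X × X)`. -/
def nabla (η : ∀ p, W p) (g : ∀ k q, PreForm I V W k q) : ∀ k q, PreForm I V W k q
  | k, 0 => (g (k + 1) 0).contract η
  | k, q + 1 => fun p e τ v =>
      (g (k + 1) (q + 1)).contract η p e τ v - (g k q).dbar FV FW p e τ v

/-- `g = ∑ g_{k,k}` is a weight for `V` with respect to the section `η` of `W`: it is smooth,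
`∇_η g = 0`, and `g_{0,0}` is the identity on the diagonal. -/
structure IsWeight (η : ∀ p, W p) (g : ∀ k q, PreForm I V W k q) : Prop where
  smooth : ∀ k q, (g k q).IsSmooth FV FW
  eq_zero : ∀ k q, k ≠ q → ∀ p e τ v, g k q p e τ v = 0
  nabla_eq_zero : ∀ k q p e τ v, nabla FV FW η g k q p e τ v = 0
  diagonal : ∀ (z : X) e τ (v : V z), g 0 0 (z, z) e τ v = v

/-- Smoothness at `p` of (the germ of) a section of `W`. -/
def SmoothSectionAt (I : ModelWithCorners ℂ E H) (ξ : ∀ p, W p) (p : X × X) : Prop :=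
  ContDiffAt ℝ ∞ (fun x : E × E =>
      (trivializationAt FW W p).continuousLinearMapAt ℂ ((extChartAt (I.prod I) p).symm x)
        (ξ ((extChartAt (I.prod I) p).symm x)))
    (extChartAt (I.prod I) p p)

/-- Smoothness at `p` of (the germ of) a section of the pullback `V_ζ` of `V` to `X × X` under the
second projection. -/
def SmoothPullbackSectionAt (I : ModelWithCorners ℂ E H) (v : ∀ p : X × X, V p.2)
    (p : X × X) : Prop :=
  ContDiffAt ℝ ∞ (fun x : E × E =>
      (trivializationAt FV V p.2).continuousLinearMapAt ℂ ((extChartAt (I.prod I) p).symm x).2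
        (v ((extChartAt (I.prod I) p).symm x)))
    (extChartAt (I.prod I) p p)

/-- The `∂̄`-derivative at `p` along `τ` of a function on `X × X` with values in a complex
vector space. -/
def dbarFun {G : Type*} [NormedAddCommGroup G] [NormedSpace ℂ G] (I : ModelWithCorners ℂ E H)
    (f : X × X → G) (p : X × X) (τ : TangentSpace (I.prod I) p) : G :=
  dbarVec (fun x => f ((extChartAt (I.prod I) p).symm x)) (extChartAt (I.prod I) p p) τ

end Weights

/-! ### The weights of the tautological bundles -/

/-- The section `η = ∑ η_j` of `E`, where `η_j(z, ζ) v = q_{j,z} v` for `v ∈ H_{j,ζ}`. -/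
def eta (p : FlagMfd t × FlagMfd t) : DiagBundle t p :=
  ⟨fun j => (p.1.V j.castSucc).mkQ.comp (p.2.V j.castSucc).subtype, fun _ _ _ _ => rfl⟩

/-- The identification `φ_i : F_i = ℂ^N / H_i → H_i^⊥`, inverse to the restriction of the quotient
map to `H_i^⊥`. -/
def quotEquivPerp (F : FlagMfd t) (i : Fin (m + 1)) : (Vec N ⧸ F.V i) ≃ₗ[ℂ] (F.V i)ᗮ :=
  Submodule.quotientEquivOfIsCompl (F.V i) (F.V i)ᗮ
    (Submodule.isCompl_orthogonal _)

/-- The component `ξ_i ∈ Hom(H_{i,ζ}, F_{i,z})` of `ξ ∈ E_{(z,ζ)}`; for the last index it is zero,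
since then `F_i = 0`. -/
def component {p : FlagMfd t × FlagMfd t} (ξ : DiagBundle t p) (i : Fin (m + 1)) :
    p.2.V i →ₗ[ℂ] (Vec N ⧸ p.1.V i) :=
  Fin.lastCases (motive := fun i => p.2.V i →ₗ[ℂ] (Vec N ⧸ p.1.V i)) 0
    (fun j => ξ.1 j) i

variable (t) in
/-- The section `γ_{0,i}`: the orthogonal projection of `H_{i,ζ}` to `H_{i,z}`. -/
def gammaZero (i : Fin (m + 1)) : PreForm 𝓘(ℂ, Nil t) (Taut t i) (DiagBundle t) 0 0 :=
  fun p _ _ v => (p.1.V i).orthogonalProjectionOnto v.1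

/-- The expression `-π_{H_{i,z}} (∂̄ φ_i(ξ_i(v)))`, at `p` along the tangent vector `τ`, for
sections `ξ` of `E` and `v` of `H_{i,ζ}`. -/
def gammaOneOp (i : Fin (m + 1)) (ξ : ∀ p, DiagBundle t p) (v : ∀ p : FlagMfd t × FlagMfd t, Taut t i p.2)
    (p : FlagMfd t × FlagMfd t) (τ : TangentSpace (𝓘(ℂ, Nil t).prod 𝓘(ℂ, Nil t)) p) : Taut t i p.1 :=
  -(p.1.V i).orthogonalProjectionOnto
    (dbarFun 𝓘(ℂ, Nil t)
      (fun p' => (quotEquivPerp p'.1 i (component (ξ p') i (v p')) : Vec N)) p τ)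

variable (t) in
/-- The section `γ_{1,i}`: its value on vectors is that of the operator
`ξ ⊗ v ↦ -π_{H_{i,z}} (∂̄ φ_i(ξ_i(v)))` on sections extending them, for which
we take the sections that are constant in the holomorphic trivializations centred at the point. -/
def gammaOne (i : Fin (m + 1)) : PreForm 𝓘(ℂ, Nil t) (Taut t i) (DiagBundle t) 1 1 :=
  fun p e τ v => gammaOneOp i
    (fun p' => (trivializationAt (DiagModel t) (DiagBundle t) p).symmL ℂ p'
      ((trivializationAt (DiagModel t) (DiagBundle t) p).continuousLinearMapAt ℂ p (e 0)))
    (fun p' => (trivializationAt (TautModel t i) (Taut t i) p.2).symmL ℂ p'.2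
      ((trivializationAt (TautModel t i) (Taut t i) p.2).continuousLinearMapAt ℂ p.2 v))
    p (τ 0)

variable (t) in
/-- The family `G_i = γ_{0,i} + γ_{1,i}`. -/
def weightG (i : Fin (m + 1)) : ∀ k q, PreForm 𝓘(ℂ, Nil t) (Taut t i) (DiagBundle t) k q
  | 0, 0 => gammaZero t i
  | 1, 1 => gammaOne t i
  | _, _ => fun _ _ _ _ => 0

end

end FlagManifold

open FlagManifold
open scoped Manifold

namespace FlagManifold

open scoped Manifold ContDiff Topology InnerProductSpace
open Set Bundle

noncomputable section

/-! ### Calculus of the `∂̄`-derivative -/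

section Dbar

variable {E F G K : Type*} [NormedAddCommGroup E] [NormedSpace ℂ E] [NormedAddCommGroup F]
  [NormedSpace ℂ F] [NormedAddCommGroup G] [NormedSpace ℂ G] [NormedAddCommGroup K]
  [NormedSpace ℂ K]

/-! Write `π` for the orthogonal projection onto `H_i`, regarded as a matrix-valued function of `z`.
Everything follows from two properties of `∂̄π`.

It annihilates `H_i`: a vector of `H_{i,z}` extends to a holomorphic local section `s` of `H_i`, and
differentiating `π s = s` gives `(∂̄π) s = 0`. It has values in `H_i`: differentiating `π² = π`
gives `∂̄π = (∂̄π)π + π ∂̄π`, whose first term vanishes by the first property. These are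
`dbarVec_projMat_apply_of_mem` and `dbarVec_projMat_mem`. That `π` is smooth, though not
holomorphic, comes from the closed formula `gramProj`.

If `w` is a smooth lift of `ξ_i(v)` to `ℂ^N`, then `φ_i(ξ_i(v)) = (1 - π) w`, so `-π ∂̄((1 - π) w) =
-π((1 - π) ∂̄w - (∂̄π) w) = π (∂̄π) w = (∂̄π) w`. The derivative of `w` has dropped out, so
`γ_{1,i}` is tensorial and equals `(∂̄π) ∘ φ_i ∘ ξ_i` (`tautVal_gammaOneOp`).

For `ξ = η` a lift of `η_i(v)` is `v` itself, whence `δ_η γ_{1,i} = ∂̄π` restricted to `H_{i,ζ}`.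
This is `∂̄γ_{0,i}`, because the inclusions of `H_{i,z}` and `H_{i,ζ}` in `ℂ^N` are holomorphic
(`contract_eta_gammaOne_eq_dbar_gammaZero`). In holomorphic frames `ξ_i(v)` has a holomorphic lift,
so `γ_{1,i}` is `∂̄π` multiplied by holomorphic factors, and `∂̄γ_{1,i} = 0` follows from `∂̄² π =
0`, that is, from the symmetry of second derivatives (`dbar_gammaOne`). These are the only
components of `∇_η G_i` that are not trivially zero, and on the diagonal `γ_{0,i}` is `π` acting on
its own range. -/

lemma dbarVec_congr {f g : E → F} {x : E} (h : f =ᶠ[𝓝 x] g) (τ : E) :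
    dbarVec f x τ = dbarVec g x τ := by
  rw [dbarVec, dbarVec, h.fderiv_eq]

lemma dbarVec_add_right (f : E → F) (x τ σ : E) :
    dbarVec f x (τ + σ) = dbarVec f x τ + dbarVec f x σ := by
  simp only [dbarVec, smul_add, map_add]; abel

lemma dbarVec_smul_right (f : E → F) (x τ : E) (c : ℝ) :
    dbarVec f x (c • τ) = c • dbarVec f x τ := by
  simp only [dbarVec, map_smul, smul_comm Complex.I c, smul_comm (1 / 2 : ℂ) c, ← smul_add]

lemma dbarVec_I_smul (f : E → F) (x τ : E) :
    dbarVec f x (Complex.I • τ) = -Complex.I • dbarVec f x τ := by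
  have h : Complex.I • Complex.I • τ = -τ := by rw [smul_smul, Complex.I_mul_I, neg_one_smul]
  have h' : Complex.I • Complex.I • fderiv ℝ f x (Complex.I • τ) = -fderiv ℝ f x (Complex.I • τ) := by
    rw [smul_smul, Complex.I_mul_I, neg_one_smul]
  rw [dbarVec, dbarVec, h, smul_comm (-Complex.I), smul_add (-Complex.I), neg_smul, neg_smul, h',
    map_neg, smul_neg, neg_neg, add_comm]

lemma dbarVec_zero_fun (x τ : E) : dbarVec (fun _ : E => (0 : F)) x τ = 0 := by
  simp [dbarVec]

/-- The derivative is complex linear, so its second term contributes `i · i = -1` times the first.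
-/
lemma dbarVec_of_differentiableAt {f : E → F} {x : E} (h : DifferentiableAt ℂ f x) (τ : E) :
    dbarVec f x τ = 0 := by
  rw [dbarVec, h.fderiv_restrictScalars ℝ, ContinuousLinearMap.coe_restrictScalars', map_smul,
    smul_smul, Complex.I_mul_I, neg_one_smul, add_neg_cancel, smul_zero]

/-- Common source of the Leibniz rules for products of matrices and for evaluation. Complex
bilinearity of `B` is what lets the factor `i` pass into either argument. -/
lemma dbarVec_bilinear (B : F →L[ℂ] G →L[ℂ] K) {f : E → F} {g : E → G} {x : E}
    (hf : DifferentiableAt ℝ f x) (hg : DifferentiableAt ℝ g x) (τ : E) :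
    dbarVec (fun y => B (f y) (g y)) x τ = B (dbarVec f x τ) (g x) + B (f x) (dbarVec g x τ) := by
  have h : HasFDerivAt (fun y => B (f y) (g y)) _ x :=
    (B.bilinearRestrictScalars ℝ).hasFDerivAt_of_bilinear hf.hasFDerivAt hg.hasFDerivAt
  have e : ∀ σ, fderiv ℝ (fun y => B (f y) (g y)) x σ =
      B (f x) (fderiv ℝ g x σ) + B (fderiv ℝ f x σ) (g x) := fun σ => by rw [h.fderiv]; rfl
  rw [dbarVec, e, e]
  simp only [dbarVec, map_add, map_smul, smul_apply, add_apply, smul_add]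
  abel

lemma dbarVec_clm_comp (L : F →L[ℂ] G) {f : E → F} {x : E} (hf : DifferentiableAt ℝ f x) (τ : E) :
    dbarVec (fun y => L (f y)) x τ = L (dbarVec f x τ) := by
  have h : HasFDerivAt (fun y => L (f y)) _ x :=
    (L.restrictScalars ℝ).hasFDerivAt.comp x hf.hasFDerivAt
  rw [dbarVec, h.fderiv]
  simp [dbarVec]

lemma dbarVec_mul {R : Type*} [NormedRing R] [NormedAlgebra ℂ R] {f g : E → R} {x : E}
    (hf : DifferentiableAt ℝ f x) (hg : DifferentiableAt ℝ g x) (τ : E) :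
    dbarVec (fun y => f y * g y) x τ = dbarVec f x τ * g x + f x * dbarVec g x τ :=
  dbarVec_bilinear (ContinuousLinearMap.mul ℂ R) hf hg τ

lemma dbarVec_clm_apply {f : E → F →L[ℂ] G} {g : E → F} {x : E}
    (hf : DifferentiableAt ℝ f x) (hg : DifferentiableAt ℝ g x) (τ : E) :
    dbarVec (fun y => f y (g y)) x τ = dbarVec f x τ (g x) + f x (dbarVec g x τ) :=
  dbarVec_bilinear (ContinuousLinearMap.id ℂ (F →L[ℂ] G)) hf hg τ

/-- The derivative of `h` commutes with multiplication by `i`, so the chain rule produces no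
`∂`-term. This makes `∂̄` independent of the holomorphic chart. -/
lemma dbarVec_comp_holomorphic {f : F → G} {h : E → F} {h' : E →L[ℂ] F} {x : E}
    (hf : DifferentiableAt ℝ f (h x)) (hh : HasFDerivAt h h' x) (τ : E) :
    dbarVec (fun y => f (h y)) x τ = dbarVec f (h x) (h' τ) := by
  have e : HasFDerivAt (fun y => f (h y)) _ x := hf.hasFDerivAt.comp x (hh.restrictScalars ℝ)
  rw [dbarVec, e.fderiv, dbarVec]
  simp

lemma contDiffAt_dbarVec {f : E → F} {x : E} (hf : ContDiffAt ℝ ∞ f x) (τ : E) :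
    ContDiffAt ℝ ∞ (fun y => dbarVec f y τ) x := by
  have h : ContDiffAt ℝ ∞ (fderiv ℝ f) x := hf.fderiv_right (by simp)
  unfold dbarVec
  exact ((h.clm_apply contDiffAt_const).add
    ((h.clm_apply contDiffAt_const).const_smul Complex.I)).const_smul (1 / 2 : ℂ)

/-- This is `∂̄² = 0` on functions, a consequence of the symmetry of the second derivative. -/
lemma dbarVec_comm {f : E → F} {x : E} (hf : ContDiffAt ℝ ∞ f x) (τ σ : E) :
    dbarVec (fun y => dbarVec f y τ) x σ = dbarVec (fun y => dbarVec f y σ) x τ := by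
  have hd : DifferentiableAt ℝ (fderiv ℝ f) x :=
    (hf.fderiv_right (m := ∞) (by simp)).differentiableAt (by simp)
  have hs : IsSymmSndFDerivAt ℝ f x := hf.isSymmSndFDerivAt (by simpa using WithTop.coe_le_coe.2 (le_top (a := (2 : ℕ∞))))
  have key : ∀ τ' σ' : E, fderiv ℝ (fun y => dbarVec f y τ') x σ' =
      (1 / 2 : ℂ) • (fderiv ℝ (fderiv ℝ f) x σ' τ' +
        Complex.I • fderiv ℝ (fderiv ℝ f) x σ' (Complex.I • τ')) := by
    intro τ' σ'
    have h1 : ∀ w : E, HasFDerivAt (fun y => fderiv ℝ f y w) _ x := fun w =>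
      hd.hasFDerivAt.clm_apply (hasFDerivAt_const w x)
    have h2 := ((h1 τ').add ((h1 (Complex.I • τ')).const_smul Complex.I)).const_smul (1 / 2 : ℂ)
    have h3 : HasFDerivAt (fun y => dbarVec f y τ') _ x := h2
    rw [h3.fderiv]
    simp
  rw [dbarVec, dbarVec, key, key, key, key]
  -- Both sides are sums of four second derivatives, in the directions `τ` or `iτ` and `σ` or `iσ`;
  -- each is transposed, and the two mixed terms then change places.
  rw [hs σ τ, hs σ (Complex.I • τ), hs (Complex.I • σ) τ, hs (Complex.I • σ) (Complex.I • τ)]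
  simp only [smul_add, smul_comm Complex.I (1 / 2 : ℂ)]
  abel

end Dbar

/-! ### Smooth dependence of orthogonal projections -/

section Projection

variable {V : Type*} [NormedAddCommGroup V] [InnerProductSpace ℂ V] [FiniteDimensional ℂ V]

/-- The positive operator `T^* T + (1 - P)`. -/
def gram (P T : V →L[ℂ] V) : V →L[ℂ] V := star T * T + (1 - P)

/-- The quadratic form of `gram P (x * P)` is `‖xPv‖² + ‖(1 - P)v‖²`. If it vanishes, then `Pv = 0`,
since `x` is invertible, and `(1 - P)v = 0`, so `v = 0`. In finite dimension injectivity suffices.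
-/
lemma isUnit_gram {P x : V →L[ℂ] V} (hP : P * P = P) (hs : star P = P) (hx : IsUnit x) :
    IsUnit (gram P (x * P)) := by
  have hinj : Function.Injective (gram P (x * P)) := by
    refine (injective_iff_map_eq_zero _).2 fun v hv => ?_
    have h1 : ⟪gram P (x * P) v, v⟫_ℂ = ‖(x * P) v‖ ^ 2 + ‖(1 - P) v‖ ^ 2 := by
      have e : gram P (x * P) = star (x * P) * (x * P) + star (1 - P) * (1 - P) := by
        rw [gram, star_sub, star_one, hs]
        congr 1
        exact (IsIdempotentElem.one_sub hP).symm
      rw [e, add_apply, inner_add_left]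
      have h2 : ∀ T : V →L[ℂ] V, ⟪(star T * T) v, v⟫_ℂ = ‖T v‖ ^ 2 := fun T => by
        rw [ContinuousLinearMap.star_eq_adjoint, mul_apply_eq_comp,
          ContinuousLinearMap.adjoint_inner_left, inner_self_eq_norm_sq_to_K]
        rfl
      rw [h2, h2]
    rw [hv, inner_zero_left] at h1
    have h3 : ‖(x * P) v‖ ^ 2 + ‖(1 - P) v‖ ^ 2 = 0 := by exact_mod_cast h1.symm
    have h4 : (x * P) v = 0 := by
      rw [← norm_eq_zero, ← sq_eq_zero_iff]; nlinarith [sq_nonneg ‖(x * P) v‖, sq_nonneg ‖(1 - P) v‖]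
    have h5 : (1 - P) v = 0 := by
      rw [← norm_eq_zero, ← sq_eq_zero_iff]; nlinarith [sq_nonneg ‖(x * P) v‖, sq_nonneg ‖(1 - P) v‖]
    have h6 : P v = 0 := by
      obtain ⟨u, rfl⟩ := hx
      have : ((u⁻¹ : (V →L[ℂ] V)ˣ) : V →L[ℂ] V) (((u : V →L[ℂ] V) * P) v) = P v := by
        rw [← mul_apply_eq_comp, ← mul_assoc, Units.inv_mul, one_mul]
      rw [← this, h4, map_zero]
    simpa [h6] using h5
  exact ⟨(ContinuousLinearEquiv.unitsEquiv ℂ V).symm (LinearEquiv.ofInjectiveEndo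
    (gram P (x * P) : V →ₗ[ℂ] V) hinj).toContinuousLinearEquiv, rfl⟩

/-- The orthogonal projection onto the range of `T`, when `gram P T` is invertible and
`T P = T`. -/
def gramProj (P T : V →L[ℂ] V) : V →L[ℂ] V := T * Ring.inverse (gram P T) * star T

/-- The usual formula `T (T* T)⁻¹ T*` fails because `T` vanishes on the kernel of `P`; the summand
`1 - P` repairs this. It does not disturb the result, since `(1 - P) T* = 0`. -/
lemma gramProj_eq {P x : V →L[ℂ] V} (hP : P * P = P) (hs : star P = P) (hx : IsUnit x)
    {U : Submodule ℂ V} (hU : ∀ v, v ∈ U ↔ ∃ w, v = (x * P) w) :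
    gramProj P (x * P) = U.starProjection := by
  set T := x * P with hT
  have hu : IsUnit (gram P T) := isUnit_gram hP hs hx
  have h1 : (1 - P) * star T = 0 := by
    rw [hT, star_mul, hs, ← mul_assoc, sub_mul, hP]; simp
  have h2 : (1 - P) * gram P T = 1 - P := by
    rw [gram, mul_add, ← mul_assoc, h1, zero_mul, zero_add, IsIdempotentElem.one_sub hP]
  have h3 : (1 - P) * Ring.inverse (gram P T) = 1 - P := by
    conv_lhs => rw [← h2]
    rw [mul_assoc, Ring.mul_inverse_cancel _ hu, mul_one]
  -- This says that `v - gramProj P T v` is orthogonal to the range of `T`, which characterizes the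
  -- projection.
  have h4 : star T * gramProj P T = star T := by
    have : star T * T = gram P T - (1 - P) := by rw [gram]; abel
    rw [gramProj, ← mul_assoc, ← mul_assoc, this, sub_mul, h3, Ring.mul_inverse_cancel _ hu, sub_mul,
      h1, one_mul, sub_zero]
  ext1 v
  symm
  refine Submodule.eq_starProjection_of_mem_of_inner_eq_zero ?_ ?_
  · rw [hU]
    exact ⟨(Ring.inverse (gram P T) * star T) v, by rw [gramProj, mul_assoc]; rfl⟩
  · intro w hw
    obtain ⟨w, rfl⟩ := (hU w).1 hw
    rw [← ContinuousLinearMap.adjoint_inner_left, ← ContinuousLinearMap.star_eq_adjoint, map_sub,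
      ← mul_apply_eq_comp, h4, sub_self, inner_zero_left]

lemma contDiffAt_gramProj {E : Type*} [NormedAddCommGroup E] [NormedSpace ℝ E] {P : V →L[ℂ] V}
    {T : E → V →L[ℂ] V} {y : E} {n : WithTop ℕ∞} (hT : ContDiffAt ℝ n T y)
    (hu : IsUnit (gram P (T y))) : ContDiffAt ℝ n (fun e => gramProj P (T e)) y := by
  -- The adjoint is conjugate linear, hence smooth only over `ℝ`; this is where holomorphy of the
  -- projection is lost.
  have hst : ContDiffAt ℝ n (fun e => star (T e)) y :=
    (starL' ℝ (A := V →L[ℂ] V)).toContinuousLinearMap.contDiff.contDiffAt.comp y hT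
  have hg : ContDiffAt ℝ n (fun e => gram P (T e)) y := (hst.mul hT).add contDiffAt_const
  obtain ⟨u, hu⟩ := hu
  have hi : ContDiffAt ℝ n Ring.inverse (gram P (T y)) := by
    rw [← hu]; exact contDiffAt_ringInverse ℝ u
  exact (hT.mul (hi.comp y hg)).mul hst

end Projection

variable {m N : ℕ} {t : FlagType m N}

/-! ### Coordinates -/

lemma star_coordProj (N c : ℕ) : star (coordProj N c) = coordProj N c := by
  rw [ContinuousLinearMap.star_eq_adjoint]
  symm
  rw [ContinuousLinearMap.eq_adjoint_iff]
  intro v w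
  simp only [PiLp.inner_apply, coordProj_apply]
  refine Finset.sum_congr rfl fun a _ => ?_
  split_ifs <;> simp

/-- The orthogonal projection onto the `i`-th member of a flag. -/
def projMat (i : Fin (m + 1)) (F : FlagMfd t) : Mat N := (F.V i).starProjection

lemma projMat_mem (i : Fin (m + 1)) (F : FlagMfd t) (v : Vec N) : projMat i F v ∈ F.V i :=
  Submodule.starProjection_apply_mem _ v

lemma projMat_eq_self {i : Fin (m + 1)} {F : FlagMfd t} {v : Vec N} (h : v ∈ F.V i) :
    projMat i F v = v := Submodule.starProjection_eq_self_iff.2 h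

lemma projMat_mul_self (i : Fin (m + 1)) (F : FlagMfd t) :
    projMat i F * projMat i F = projMat i F :=
  ContinuousLinearMap.ext fun v => projMat_eq_self (projMat_mem i F v)

lemma mem_ofGL {x : (Mat N)ˣ} {i : Fin (m + 1)} {v : Vec N} :
    v ∈ (FlagMfd.ofGL t x).V i ↔ ∃ w, v = ((x : Mat N) * t.P (i.val + 1)) w := by
  constructor
  · rintro ⟨w, hw, rfl⟩
    exact ⟨w, by rw [mat_mul_apply, t.mem_refSub.1 hw]; rfl⟩
  · rintro ⟨w, rfl⟩
    exact ⟨_, t.P_mem i w, rfl⟩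

/-- With this formula, smoothness of the projection reduces to that of a representing matrix. -/
lemma projMat_ofGL (i : Fin (m + 1)) (x : (Mat N)ˣ) :
    projMat i (FlagMfd.ofGL t x) = gramProj (t.P (i.val + 1)) ((x : Mat N) * t.P (i.val + 1)) :=
  (gramProj_eq (t.isChain.idem _) (star_coordProj _ _) x.isUnit fun _ => mem_ofGL).symm

/-- The matrix `g (1 + B)`. -/
def frame (g : (Mat N)ˣ) (B : Nil t) : (Mat N)ˣ := g * unip t B

lemma frame_mem {g : (Mat N)ˣ} {B : Nil t} {i : Fin (m + 1)} {v : Vec N} (h : v ∈ t.refSub i) :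
    (frame g B : Mat N) v ∈ (FlagMfd.ofGL t (frame g B)).V i := ⟨v, h, rfl⟩

/-! ### The `∂̄`-derivative of the projection onto a tautological bundle. -/

section Smooth

variable {E : Type*} [NormedAddCommGroup E] [NormedSpace ℂ E] (L : E →L[ℂ] Nil t) (g : (Mat N)ˣ)

/-- The linear map `L` allows the statements of this section to be used on a chart of `X × X`, with
`L` the projection to one of the factors. -/
lemma contDiff_frame (n : WithTop ℕ∞) : ContDiff ℂ n (fun x : E => (frame g (L x) : Mat N)) :=
  contDiff_const.mul (contDiff_const.add ((Nil t).subtypeL.contDiff.comp L.contDiff))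

lemma contDiff_frame_inv (n : WithTop ℕ∞) :
    ContDiff ℂ n (fun x : E => ((frame g (L x))⁻¹.val : Mat N)) := by
  have e : (fun x : E => ((frame g (L x))⁻¹.val : Mat N))
      = fun x => Ring.inverse (frame g (L x) : Mat N) := funext fun x => (Ring.inverse_unit _).symm
  rw [e]
  exact contDiff_iff_contDiffAt.2 fun x =>
    ContDiffAt.comp x (g := Ring.inverse) (contDiffAt_ringInverse ℂ (frame g (L x)))
      (contDiff_frame L g n).contDiffAt

lemma contDiff_projMat (i : Fin (m + 1)) :
    ContDiff ℝ ∞ (fun x : E => projMat i (FlagMfd.ofGL t (frame g (L x)))) := by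
  simp only [projMat_ofGL]
  refine contDiff_iff_contDiffAt.2 fun x => contDiffAt_gramProj ?_
    (isUnit_gram (t.isChain.idem _) (star_coordProj _ _) (frame g (L x)).isUnit)
  exact ((contDiff_frame L g ∞).restrict_scalars ℝ).contDiffAt.mul contDiffAt_const

variable (i : Fin (m + 1)) (x τ : E)

/-- The vector `v` is the value at `x` of the holomorphic section `y ↦ frame g (L y) w`, which the
projection fixes. In the Leibniz rule for this identity only the derivative of the projection
remains. -/
lemma dbarVec_projMat_apply_of_mem {v : Vec N} (hv : v ∈ (FlagMfd.ofGL t (frame g (L x))).V i) :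
    dbarVec (fun y => projMat i (FlagMfd.ofGL t (frame g (L y)))) x τ v = 0 := by
  obtain ⟨w, hw, rfl⟩ := hv
  have h1 : DifferentiableAt ℝ (fun y => projMat i (FlagMfd.ofGL t (frame g (L y)))) x :=
    (contDiff_projMat L g i).contDiffAt.differentiableAt (by simp)
  have h2 : DifferentiableAt ℂ (fun y => (frame g (L y) : Mat N) w) x :=
    ((contDiff_frame L g 1).clm_apply contDiff_const).contDiffAt.differentiableAt (by simp)
  have h3 := dbarVec_clm_apply h1 (h2.restrictScalars ℝ) τ
  rw [dbarVec_of_differentiableAt h2, map_zero, add_zero] at h3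
  refine h3.symm.trans ?_
  rw [show (fun y => projMat i (FlagMfd.ofGL t (frame g (L y))) ((frame g (L y) : Mat N) w)) =
    fun y => (frame g (L y) : Mat N) w from funext fun y => projMat_eq_self (frame_mem hw)]
  exact dbarVec_of_differentiableAt h2 τ

/-- Differentiating `π² = π` gives `∂̄π = (∂̄π)π + π ∂̄π`, and the first summand is zero by
`dbarVec_projMat_apply_of_mem`. -/
lemma dbarVec_projMat_mem (v : Vec N) :
    dbarVec (fun y => projMat i (FlagMfd.ofGL t (frame g (L y)))) x τ v ∈
      (FlagMfd.ofGL t (frame g (L x))).V i := by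
  have h1 : DifferentiableAt ℝ (fun y => projMat i (FlagMfd.ofGL t (frame g (L y)))) x :=
    (contDiff_projMat L g i).contDiffAt.differentiableAt (by simp)
  have h2 := dbarVec_mul h1 h1 τ
  simp only [projMat_mul_self] at h2
  have h3 := congrArg (fun A : Mat N => A v) h2
  simp only [add_apply, mat_mul_apply] at h3
  rw [dbarVec_projMat_apply_of_mem L g i x τ (projMat_mem _ _ _), zero_add] at h3
  rw [h3]
  exact projMat_mem _ _ _

end Smooth

/-! ### Local trivializations -/

/-- The target of every chart is the whole of `Nil t`, so `B` is unrestricted here and the local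
formulas below need no condition on the domain. -/
lemma flagChart_ofGL_frame (g : (Mat N)ˣ) (B : Nil t) :
    flagChart g (FlagMfd.ofGL t (frame g B)) = B :=
  (flagChart (t := t) g).right_inv (mem_univ B)

lemma moving_ofGL_frame (g : (Mat N)ˣ) (B : Nil t) :
    moving g (FlagMfd.ofGL t (frame g B)) = frame g B := by
  rw [moving, flagChart_ofGL_frame]; rfl

lemma ofGL_frame_mem_source (g : (Mat N)ˣ) (B : Nil t) :
    FlagMfd.ofGL t (frame g B) ∈ (flagChart (t := t) g).source :=
  (flagChart (t := t) g).map_target (mem_univ B)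

/-- The preferred trivialization at `F₀` is, by construction, the member of `tautAtlas` with index
`F₀.rep`; the same frame gives the preferred chart, so both are expressed by one matrix. -/
lemma tautTriv_apply (i : Fin (m + 1)) {F₀ F : FlagMfd t}
    (h : F ∈ (flagChart (t := t) F₀.rep).source) (v : Taut t i F) :
    (trivializationAt (TautModel t i) (Taut t i) F₀).continuousLinearMapAt ℂ F v
      = tautEquiv i (carries_moving h) v := by
  rw [Trivialization.continuousLinearMapAt_apply_of_mem]
  · exact congrArg Prod.snd ((tautAtlas t i).pretriv_apply F₀.rep h v)
  · exact h

lemma tautTriv_symm (i : Fin (m + 1)) {F₀ F : FlagMfd t}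
    (h : F ∈ (flagChart (t := t) F₀.rep).source) (c : TautModel t i) :
    (trivializationAt (TautModel t i) (Taut t i) F₀).symmL ℂ F c
      = (tautEquiv i (carries_moving h)).symm c := by
  rw [LinearEquiv.eq_symm_apply, ← tautTriv_apply i h,
    Trivialization.continuousLinearMapAt_symmL _ (by exact h)]

lemma diagTriv_apply {p₀ p : FlagMfd t × FlagMfd t}
    (h₁ : p.1 ∈ (flagChart (t := t) p₀.1.rep).source)
    (h₂ : p.2 ∈ (flagChart (t := t) p₀.2.rep).source) (f : DiagBundle t p) :
    (trivializationAt (DiagModel t) (DiagBundle t) p₀).continuousLinearMapAt ℂ p f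
      = diagTriv (carries_moving h₁) (carries_moving h₂) f := by
  rw [Trivialization.continuousLinearMapAt_apply_of_mem]
  · exact congrArg Prod.snd ((diagAtlas t).pretriv_apply (p₀.1.rep, p₀.2.rep) ⟨h₁, h₂⟩ f)
  · exact ⟨h₁, h₂⟩

/-- The point with coordinates `x` in the chart centred at `p`. -/
def chartPt (p : FlagMfd t × FlagMfd t) (x : Nil t × Nil t) : FlagMfd t × FlagMfd t :=
  (FlagMfd.ofGL t (frame p.1.rep x.1), FlagMfd.ofGL t (frame p.2.rep x.2))

lemma extChartAt_symm_eq (p : FlagMfd t × FlagMfd t) (x : Nil t × Nil t) :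
    (extChartAt (𝓘(ℂ, Nil t).prod 𝓘(ℂ, Nil t)) p).symm x = chartPt p x := rfl

/-- The inclusion of a fibre of `H_i` in `ℂ^N`. -/
def tautVal (i : Fin (m + 1)) (F : FlagMfd t) : Taut t i F →ₗ[ℂ] Vec N := (F.V i).subtype

lemma tautVal_injective (i : Fin (m + 1)) (F : FlagMfd t) : Function.Injective (tautVal i F) :=
  Subtype.val_injective

lemma tautVal_mem {i : Fin (m + 1)} {F : FlagMfd t} (v : Taut t i F) : tautVal i F v ∈ F.V i :=
  Subtype.property _

lemma coe_tautEquiv (i : Fin (m + 1)) {x : (Mat N)ˣ} {F : FlagMfd t}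
    (h : Carries x (FlagMfd.ref t) F) (v : Taut t i F) :
    (tautEquiv i h v : Vec N) = x⁻¹.val (tautVal i F v) := rfl

lemma tautVal_tautEquiv_symm (i : Fin (m + 1)) {x : (Mat N)ˣ} {F : FlagMfd t}
    (h : Carries x (FlagMfd.ref t) F) (c : TautModel t i) :
    tautVal i F ((tautEquiv i h).symm c) = x.val c.1 := rfl

lemma coe_tautTriv_frame (i : Fin (m + 1)) (F : FlagMfd t) (B : Nil t)
    (v : Taut t i (FlagMfd.ofGL t (frame F.rep B))) :
    ((trivializationAt (TautModel t i) (Taut t i) F).continuousLinearMapAt ℂ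
      (FlagMfd.ofGL t (frame F.rep B)) v : Vec N) = (frame F.rep B)⁻¹.val (tautVal i _ v) := by
  rw [tautTriv_apply i (ofGL_frame_mem_source _ _), coe_tautEquiv, moving_ofGL_frame]

lemma tautVal_tautTriv_symm_frame (i : Fin (m + 1)) (F : FlagMfd t) (B : Nil t)
    (c : TautModel t i) :
    tautVal i _ ((trivializationAt (TautModel t i) (Taut t i) F).symmL ℂ
      (FlagMfd.ofGL t (frame F.rep B)) c) = (frame F.rep B : Mat N) c.1 := by
  rw [tautTriv_symm i (ofGL_frame_mem_source _ _), tautVal_tautEquiv_symm, moving_ofGL_frame]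

/-! ### Lifts of the components of sections of `E` -/

lemma component_castSucc {p : FlagMfd t × FlagMfd t} (ξ : DiagBundle t p) (j : Fin m) :
    component ξ j.castSucc = ξ.1 j :=
  Fin.lastCases_castSucc (motive := fun i => p.2.V i →ₗ[ℂ] (Vec N ⧸ p.1.V i)) _

lemma component_last {p : FlagMfd t × FlagMfd t} (ξ : DiagBundle t p) :
    component ξ (Fin.last m) = 0 :=
  Fin.lastCases_last (motive := fun i => p.2.V i →ₗ[ℂ] (Vec N ⧸ p.1.V i))

lemma component_add {p : FlagMfd t × FlagMfd t} (ξ ξ' : DiagBundle t p) (i : Fin (m + 1)) :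
    component (ξ + ξ') i = component ξ i + component ξ' i := by
  induction i using Fin.lastCases with
  | last => simp only [component_last, add_zero]
  | cast j => simp only [component_castSucc]; rfl

lemma component_smul {p : FlagMfd t × FlagMfd t} (c : ℂ) (ξ : DiagBundle t p) (i : Fin (m + 1)) :
    component (c • ξ) i = c • component ξ i := by
  induction i using Fin.lastCases with
  | last => simp only [component_last, smul_zero]
  | cast j => simp only [component_castSucc]; rfl

/-- The bilinear map `(ξ, v) ↦ φ_i (ξ_i v)`. -/
def perpLift (i : Fin (m + 1)) (p : FlagMfd t × FlagMfd t) :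
    DiagBundle t p →ₗ[ℂ] Taut t i p.2 →ₗ[ℂ] Vec N where
  toFun ξ := ((p.1.V i)ᗮ.subtype.comp (quotEquivPerp p.1 i).toLinearMap).comp (component ξ i)
  map_add' ξ ξ' := by rw [component_add]; exact LinearMap.comp_add _ _ _
  map_smul' c ξ := by rw [component_smul]; exact LinearMap.comp_smul _ _ _

/-- `w - πw` is the representative of the class of `w` in the orthogonal complement. Thus `φ_i`
becomes `1 - π` applied to an arbitrary lift. -/
lemma quotEquivPerp_mkQ (F : FlagMfd t) (i : Fin (m + 1)) (w : Vec N) :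
    (quotEquivPerp F i ((F.V i).mkQ w) : Vec N) = w - projMat i F w := by
  have h : w - projMat i F w ∈ (F.V i)ᗮ := Submodule.sub_starProjection_mem_orthogonal w
  have e : (F.V i).mkQ w = (F.V i).mkQ (w - projMat i F w) := by
    have h0 : (F.V i).mkQ (projMat i F w) = 0 :=
      (Submodule.Quotient.mk_eq_zero _).2 (projMat_mem i F w)
    rw [map_sub, h0, sub_zero]
  rw [e]
  exact congrArg Subtype.val (Submodule.quotientEquivOfIsCompl_apply_mk_right _
    (⟨_, h⟩ : (F.V i)ᗮ))

lemma perpLift_of_component {i : Fin (m + 1)} {p : FlagMfd t × FlagMfd t} {ξ : DiagBundle t p}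
    {v : Taut t i p.2} {w : Vec N} (h : component ξ i v = (p.1.V i).mkQ w) :
    perpLift i p ξ v = w - projMat i p.1 w := by
  rw [← quotEquivPerp_mkQ, ← h]; rfl

/-- The lift is `s ∘ f_j ∘ ρ`, where `s` is a fixed section of the quotient map and `ρ` a fixed
retraction onto the subspace. Since it is linear in `f`, it will be holomorphic in holomorphic
frames. -/
lemma exists_linear_lift (j : Fin m) :
    ∃ Λ : diagFiber (FlagMfd.ref t) (FlagMfd.ref t) →ₗ[ℂ] Mat N, ∀ f (u : t.refSub j.castSucc),
      f.1 j u = (t.refSub j.castSucc).mkQ (Λ f u.1) := by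
  obtain ⟨ρ, hρ⟩ := exists_proj (t.refSub j.castSucc)
  obtain ⟨s, hs⟩ := LinearMap.exists_rightInverse_of_surjective (t.refSub j.castSucc).mkQ
    (LinearMap.range_eq_top.2 (Submodule.mkQ_surjective _))
  refine ⟨{ toFun := fun f => LinearMap.toContinuousLinearMap
              (s.comp ((f.1 j).comp ρ.toLinearMap))
            map_add' := fun f f' => by ext1 v; exact map_add s _ _
            map_smul' := fun a f => by ext1 v; exact map_smul s _ _ }, fun f u => ?_⟩
  have h : f.1 j (ρ u.1) = f.1 j u := congrArg (f.1 j) (hρ u)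
  rw [← h]
  exact (LinearMap.congr_fun hs (f.1 j (ρ u.1))).symm

variable (t) in
/-- The coordinates of an element of the fibre of `E` over the pair of reference flags. -/
def refCoord : diagFiber (FlagMfd.ref t) (FlagMfd.ref t) ≃ₗ[ℂ] DiagModel t :=
  (Module.finBasis ℂ (diagFiber (FlagMfd.ref t) (FlagMfd.ref t))).equivFun

lemma diagTriv_val_apply {x y : (Mat N)ˣ} {p : FlagMfd t × FlagMfd t}
    (hx : Carries x (FlagMfd.ref t) p.1) (hy : Carries y (FlagMfd.ref t) p.2)
    (ξ : DiagBundle t p) (j : Fin m) (v : p.2.V j.castSucc) :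
    ξ.1 j v = ((FlagMfd.ref t).V j.castSucc).mapQ (p.1.V j.castSucc)
      (x.val : Vec N →ₗ[ℂ] Vec N) (fun v hv => (hx j.castSucc v).1 hv)
      (((refCoord t).symm (diagTriv hx hy ξ)).1 j ⟨y⁻¹.val v.1, (hy.inv j.castSucc v.1).1 v.2⟩) := by
  have h1 : (refCoord t).symm (diagTriv hx hy ξ) = (diagEquiv hx hy).symm ξ :=
    (refCoord t).symm_apply_apply _
  have h2 : ξ = diagEquiv hx hy ((diagEquiv hx hy).symm ξ) :=
    ((diagEquiv hx hy).apply_symm_apply ξ).symm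
  rw [h1]
  conv_lhs => rw [h2]
  exact diagMap_apply hx hy _ j v

/-- One map `Λ` serves all points and all frames `x`, `y`, because the trivialization of `E` is
conjugation `f ↦ x ∘ f ∘ y⁻¹` to the reference fibre. Only the factors `x` and `y⁻¹` vary with the
point, and they are holomorphic in the charts. -/
lemma exists_component_lift (i : Fin (m + 1)) : ∃ Λ : DiagModel t →L[ℂ] Mat N,
    ∀ {x y : (Mat N)ˣ} {p : FlagMfd t × FlagMfd t} (hx : Carries x (FlagMfd.ref t) p.1)
      (hy : Carries y (FlagMfd.ref t) p.2) (ξ : DiagBundle t p) (v : p.2.V i),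
      component ξ i v = (p.1.V i).mkQ (x.val (Λ (diagTriv hx hy ξ) (y⁻¹.val v.1))) := by
  induction i using Fin.lastCases with
  | last =>
    -- The last component of `ξ` is zero by convention.
    refine ⟨0, fun {x y p} hx hy ξ v => ?_⟩
    rw [component_last, LinearMap.zero_apply, zero_apply, zero_apply, map_zero, map_zero]
  | cast j =>
    obtain ⟨Λ, hΛ⟩ := exists_linear_lift (t := t) j
    refine ⟨LinearMap.toContinuousLinearMap (Λ.comp (refCoord t).symm.toLinearMap),
      fun {x y p} hx hy ξ v => ?_⟩
    rw [component_castSucc, diagTriv_val_apply hx hy]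
    exact congrArg _ (hΛ _ _)

/-! ### The operator `γ_{1,i}` -/

lemma dbarVec_one_sub_apply {E : Type*} [NormedAddCommGroup E] [NormedSpace ℂ E] {Q : E → Mat N}
    {w : E → Vec N} {x : E} (hQ : DifferentiableAt ℝ Q x) (hw : DifferentiableAt ℝ w x) (τ : E) :
    dbarVec (fun y => (1 - Q y) (w y)) x τ
      = (1 - Q x) (dbarVec w x τ) - dbarVec Q x τ (w x) := by
  have h : dbarVec (fun y => 1 - Q y) x τ = -dbarVec Q x τ := by
    rw [dbarVec, dbarVec, fderiv_const_sub]
    simp only [neg_apply, smul_neg, ← neg_add]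
  rw [dbarVec_clm_apply (hQ.const_sub 1) hw, h, neg_apply]
  abel

/-- The orthogonal projection onto `H_{i,z}` in the chart centred at `p`. -/
def projChart (i : Fin (m + 1)) (p : FlagMfd t × FlagMfd t) (x : Nil t × Nil t) : Mat N :=
  projMat i (chartPt p x).1

/-- The centre of the chart centred at `p`. -/
abbrev centre (p : FlagMfd t × FlagMfd t) : Nil t × Nil t :=
  extChartAt (𝓘(ℂ, Nil t).prod 𝓘(ℂ, Nil t)) p p

lemma chartPt_centre (p : FlagMfd t × FlagMfd t) : chartPt p (centre p) = p := by
  rw [← extChartAt_symm_eq]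
  exact extChartAt_to_inv p

/-- The operator `∂̄ π_{H_i}` along `τ`. -/
def dbarProj (i : Fin (m + 1)) (p : FlagMfd t × FlagMfd t) (τ : Nil t × Nil t) : Mat N :=
  dbarVec (projChart i p) (centre p) τ

/-! ### The projection onto `H_{i,z}` and its `∂̄`-derivative in a chart of `X × X`. -/

section

variable (i : Fin (m + 1)) (p : FlagMfd t × FlagMfd t)

lemma contDiffAt_projChart (x : Nil t × Nil t) : ContDiffAt ℝ ∞ (projChart i p) x :=
  (contDiff_projMat (ContinuousLinearMap.fst ℂ (Nil t) (Nil t)) p.1.rep i).contDiffAt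

lemma differentiableAt_projChart (x : Nil t × Nil t) : DifferentiableAt ℝ (projChart i p) x :=
  (contDiffAt_projChart i p x).differentiableAt (by simp)

lemma dbarVec_projChart_apply_of_mem (x τ : Nil t × Nil t) {v : Vec N}
    (hv : v ∈ (chartPt p x).1.V i) : dbarVec (projChart i p) x τ v = 0 :=
  dbarVec_projMat_apply_of_mem (ContinuousLinearMap.fst ℂ (Nil t) (Nil t)) p.1.rep i x τ hv

lemma dbarVec_projChart_mem (x τ : Nil t × Nil t) (v : Vec N) :
    dbarVec (projChart i p) x τ v ∈ (chartPt p x).1.V i :=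
  dbarVec_projMat_mem (ContinuousLinearMap.fst ℂ (Nil t) (Nil t)) p.1.rep i x τ v

variable {i p} in
lemma dbarProj_apply_of_mem (τ : Nil t × Nil t) {v : Vec N} (hv : v ∈ p.1.V i) :
    dbarProj i p τ v = 0 :=
  dbarVec_projChart_apply_of_mem i p _ τ (by rwa [chartPt_centre])

lemma dbarProj_mem (τ : Nil t × Nil t) (v : Vec N) : dbarProj i p τ v ∈ p.1.V i := by
  have h := dbarVec_projChart_mem i p (centre p) τ v
  rwa [chartPt_centre] at h

/-- Consequently `φ_i(ξ_i(v))` may be replaced by any lift of `ξ_i(v)` under `∂̄π`. -/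
lemma dbarProj_sub_projMat (τ : Nil t × Nil t) (v : Vec N) :
    dbarProj i p τ (v - projMat i p.1 v) = dbarProj i p τ v := by
  rw [map_sub, dbarProj_apply_of_mem τ (projMat_mem i p.1 v), sub_zero]

lemma contDiff_frame_fst (n : WithTop ℕ∞) :
    ContDiff ℂ n (fun x : Nil t × Nil t => (frame p.1.rep x.1 : Mat N)) :=
  contDiff_frame (ContinuousLinearMap.fst ℂ (Nil t) (Nil t)) p.1.rep n

lemma contDiff_frame_snd (n : WithTop ℕ∞) :
    ContDiff ℂ n (fun x : Nil t × Nil t => (frame p.2.rep x.2 : Mat N)) :=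
  contDiff_frame (ContinuousLinearMap.snd ℂ (Nil t) (Nil t)) p.2.rep n

lemma contDiff_frame_inv_fst (n : WithTop ℕ∞) :
    ContDiff ℂ n (fun x : Nil t × Nil t => ((frame p.1.rep x.1)⁻¹.val : Mat N)) :=
  contDiff_frame_inv (ContinuousLinearMap.fst ℂ (Nil t) (Nil t)) p.1.rep n

end

/-- The factor `1 - π` is the only non-holomorphic dependence on the point when the coordinates of
`ξ` and `v` are constant. -/
lemma exists_perpLift_chartPt (i : Fin (m + 1)) : ∃ Λ : DiagModel t →L[ℂ] Mat N,
    ∀ (p : FlagMfd t × FlagMfd t) (x : Nil t × Nil t) (ξ : DiagBundle t (chartPt p x))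
      (v : Taut t i (chartPt p x).2), perpLift i (chartPt p x) ξ v = (1 - projChart i p x)
        ((frame p.1.rep x.1 : Mat N) (Λ
          ((trivializationAt (DiagModel t) (DiagBundle t) p).continuousLinearMapAt ℂ (chartPt p x) ξ)
          ((trivializationAt (TautModel t i) (Taut t i) p.2).continuousLinearMapAt ℂ
            (chartPt p x).2 v : TautModel t i).1)) := by
  obtain ⟨Λ, hΛ⟩ := exists_component_lift (t := t) i
  refine ⟨Λ, fun p x ξ v => ?_⟩
  have h1 : (chartPt p x).1 ∈ (flagChart (t := t) p.1.rep).source := ofGL_frame_mem_source _ _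
  have h2 : (chartPt p x).2 ∈ (flagChart (t := t) p.2.rep).source := ofGL_frame_mem_source _ _
  rw [perpLift_of_component (hΛ (carries_moving h1) (carries_moving h2) ξ v), diagTriv_apply h1 h2,
    tautTriv_apply i h2]
  have e1 : moving p.1.rep (chartPt p x).1 = frame p.1.rep x.1 := moving_ofGL_frame _ _
  rw [← e1]
  rfl

/-- The right side involves `ξ` and `v` only through their values at `p`: this is the tensoriality
of `γ_{1,i}`. -/
theorem tautVal_gammaOneOp (i : Fin (m + 1)) (p : FlagMfd t × FlagMfd t) (ξ : ∀ p, DiagBundle t p)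
    (v : ∀ p : FlagMfd t × FlagMfd t, Taut t i p.2)
    (hξ : SmoothSectionAt (DiagModel t) 𝓘(ℂ, Nil t) ξ p)
    (hv : SmoothPullbackSectionAt (TautModel t i) 𝓘(ℂ, Nil t) v p) (τ : Nil t × Nil t) :
    tautVal i p.1 (gammaOneOp i ξ v p τ) = dbarProj i p τ (perpLift i p (ξ p) (v p)) := by
  obtain ⟨Λ, hΛ⟩ := exists_perpLift_chartPt (t := t) i
  let c : Nil t × Nil t → DiagModel t := fun x =>
    (trivializationAt (DiagModel t) (DiagBundle t) p).continuousLinearMapAt ℂ (chartPt p x)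
      (ξ (chartPt p x))
  let u : Nil t × Nil t → TautModel t i := fun x =>
    (trivializationAt (TautModel t i) (Taut t i) p.2).continuousLinearMapAt ℂ (chartPt p x).2
      (v (chartPt p x))
  have hc : DifferentiableAt ℝ c (centre p) := hξ.differentiableAt (by simp)
  have hu : DifferentiableAt ℝ u (centre p) := hv.differentiableAt (by simp)
  -- A smooth lift of `ξ_i(v)` to `ℂ^N`.
  let w : Nil t × Nil t → Vec N := fun x => (frame p.1.rep x.1 : Mat N) (Λ (c x) (u x).1)
  have happ : ∀ {A : Nil t × Nil t → Mat N} {b : Nil t × Nil t → Vec N},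
      DifferentiableAt ℝ A (centre p) → DifferentiableAt ℝ b (centre p) →
      DifferentiableAt ℝ (fun x => A x (b x)) (centre p) := fun hA hb =>
    (((ContinuousLinearMap.id ℂ (Mat N)).bilinearRestrictScalars ℝ).hasFDerivAt_of_bilinear
      hA.hasFDerivAt hb.hasFDerivAt).differentiableAt
  have hw : DifferentiableAt ℝ w (centre p) := by
    refine happ ((contDiff_frame_fst p 1).contDiffAt.differentiableAt (by simp)
      |>.restrictScalars ℝ) (happ ?_ ?_)
    · exact (Λ.restrictScalars ℝ).differentiableAt.comp _ hc
    · exact ((t.refSub i).subtypeL.restrictScalars ℝ).differentiableAt.comp _ hu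
  have e1 : (fun x => (quotEquivPerp (chartPt p x).1 i
      (component (ξ (chartPt p x)) i (v (chartPt p x))) : Vec N))
      = fun x => (1 - projChart i p x) (w x) := funext fun x => hΛ p x _ _
  have e2 : tautVal i p.1 (gammaOneOp i ξ v p τ) = -projMat i p.1 (dbarVec (fun x =>
      (quotEquivPerp (chartPt p x).1 i
      (component (ξ (chartPt p x)) i (v (chartPt p x))) : Vec N)) (centre p) τ) := rfl
  have e3 : projChart i p (centre p) = projMat i p.1 := by rw [projChart, chartPt_centre]
  have e4 : perpLift i p (ξ p) (v p) = (1 - projMat i p.1) (w (centre p)) := by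
    have h := hΛ p (centre p) (ξ _) (v _)
    rw [e3] at h
    -- The fibres over `chartPt p (centre p)` and over `p` agree only through `chartPt_centre`, so
    -- the equation is transported by rewriting.
    have h5 : perpLift i (chartPt p (centre p)) (ξ (chartPt p (centre p))) (v (chartPt p (centre p)))
        = perpLift i p (ξ p) (v p) := by rw [chartPt_centre]
    exact h5.symm.trans h
  have e5 : (1 - projMat i p.1) (w (centre p)) = w (centre p) - projMat i p.1 (w (centre p)) := rfl
  -- In `-π((1 - π) ∂̄w - (∂̄π) w)` the first term dies because `π(1 - π) = 0`; the outer `π` in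
  -- `π(∂̄π)w` is then superfluous, as `∂̄π` has values in `H_i`.
  rw [e2, e1, dbarVec_one_sub_apply (differentiableAt_projChart i p _) hw, e3, e4, e5,
    dbarProj_sub_projMat, map_sub, ← mat_mul_apply, mul_sub, mul_one, projMat_mul_self, sub_self,
    zero_apply, zero_sub, neg_neg]
  exact projMat_eq_self (dbarProj_mem i p τ _)

/-! ### Tensoriality: the sections with constant coordinates used in `gammaOne` are admissible
extensions. -/

lemma smoothSectionAt_symmL (p : FlagMfd t × FlagMfd t) (c : DiagModel t) :
    SmoothSectionAt (DiagModel t) 𝓘(ℂ, Nil t)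
      (fun p' => (trivializationAt (DiagModel t) (DiagBundle t) p).symmL ℂ p' c) p := by
  have e : (fun x : Nil t × Nil t =>
      (trivializationAt (DiagModel t) (DiagBundle t) p).continuousLinearMapAt ℂ (chartPt p x)
        ((trivializationAt (DiagModel t) (DiagBundle t) p).symmL ℂ (chartPt p x) c)) = fun _ => c :=
    funext fun x => Trivialization.continuousLinearMapAt_symmL _
      (by exact ⟨ofGL_frame_mem_source _ _, ofGL_frame_mem_source _ _⟩) c
  have h : ContDiffAt ℝ ∞ (fun _ : Nil t × Nil t => c) (centre p) := contDiffAt_const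
  rw [← e] at h
  exact h

lemma smoothPullbackSectionAt_symmL (i : Fin (m + 1)) (p : FlagMfd t × FlagMfd t)
    (c : TautModel t i) : SmoothPullbackSectionAt (TautModel t i) 𝓘(ℂ, Nil t)
      (fun p' => (trivializationAt (TautModel t i) (Taut t i) p.2).symmL ℂ p'.2 c) p := by
  have e : (fun x : Nil t × Nil t =>
      (trivializationAt (TautModel t i) (Taut t i) p.2).continuousLinearMapAt ℂ (chartPt p x).2
        ((trivializationAt (TautModel t i) (Taut t i) p.2).symmL ℂ (chartPt p x).2 c)) =
      fun _ => c :=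
    funext fun x => Trivialization.continuousLinearMapAt_symmL _
      (by exact ofGL_frame_mem_source _ _) c
  have h : ContDiffAt ℝ ∞ (fun _ : Nil t × Nil t => c) (centre p) := contDiffAt_const
  rw [← e] at h
  exact h

lemma diagTriv_symmL_self (p : FlagMfd t × FlagMfd t) (f : DiagBundle t p) :
    (trivializationAt (DiagModel t) (DiagBundle t) p).symmL ℂ p
      ((trivializationAt (DiagModel t) (DiagBundle t) p).continuousLinearMapAt ℂ p f) = f :=
  Trivialization.symmL_continuousLinearMapAt _ (FiberBundle.mem_baseSet_trivializationAt' p) f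

lemma tautTriv_symmL_self (i : Fin (m + 1)) (F : FlagMfd t) (v : Taut t i F) :
    (trivializationAt (TautModel t i) (Taut t i) F).symmL ℂ F
      ((trivializationAt (TautModel t i) (Taut t i) F).continuousLinearMapAt ℂ F v) = v :=
  Trivialization.symmL_continuousLinearMapAt _ (FiberBundle.mem_baseSet_trivializationAt' F) v

/-- This pointwise formula takes the place of the definition of `gammaOne` from here on. -/
theorem tautVal_gammaOne (i : Fin (m + 1)) (p : FlagMfd t × FlagMfd t)
    (e : Fin 1 → DiagBundle t p) (τ : Fin 1 → Nil t × Nil t) (v : Taut t i p.2) :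
    tautVal i p.1 (gammaOne t i p e τ v) = dbarProj i p (τ 0) (perpLift i p (e 0) v) := by
  refine (tautVal_gammaOneOp i p _ _ (smoothSectionAt_symmL p _)
    (smoothPullbackSectionAt_symmL i p _) (τ 0)).trans ?_
  rw [diagTriv_symmL_self, tautTriv_symmL_self]

theorem gammaOne_eq_gammaOneOp (i : Fin (m + 1)) (p : FlagMfd t × FlagMfd t)
    (ξ : ∀ p, DiagBundle t p) (v : ∀ p : FlagMfd t × FlagMfd t, Taut t i p.2)
    (hξ : SmoothSectionAt (DiagModel t) 𝓘(ℂ, Nil t) ξ p)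
    (hv : SmoothPullbackSectionAt (TautModel t i) 𝓘(ℂ, Nil t) v p)
    (τ : TangentSpace (𝓘(ℂ, Nil t).prod 𝓘(ℂ, Nil t)) p) :
    gammaOne t i p (fun _ => ξ p) (fun _ => τ) (v p) = gammaOneOp i ξ v p τ :=
  tautVal_injective i p.1 ((tautVal_gammaOne i p _ (fun _ => τ) _).trans
    (tautVal_gammaOneOp i p ξ v hξ hv τ).symm)

/-! ### Local coefficients -/

lemma extChartAt_chartPt (p : FlagMfd t × FlagMfd t) (x : Nil t × Nil t) :
    extChartAt (𝓘(ℂ, Nil t).prod 𝓘(ℂ, Nil t)) p (chartPt p x) = x :=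
  Prod.ext (flagChart_ofGL_frame _ _) (flagChart_ofGL_frame _ _)

lemma chartPt_mem_source (p : FlagMfd t × FlagMfd t) (x : Nil t × Nil t) :
    chartPt p x ∈ (extChartAt (𝓘(ℂ, Nil t).prod 𝓘(ℂ, Nil t)) p).source := by
  rw [extChartAt_source]
  exact ⟨ofGL_frame_mem_source _ _, ofGL_frame_mem_source _ _⟩

lemma continuous_chartPt (p : FlagMfd t × FlagMfd t) : Continuous (chartPt p) := by
  have h : ∀ g : (Mat N)ˣ, Continuous fun B : Nil t => FlagMfd.ofGL t (frame g B) := fun g =>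
    isQuotientMap_ofGL.continuous.comp (continuous_const.mul continuous_unip)
  exact ((h _).comp continuous_fst).prodMk ((h _).comp continuous_snd)

/-- `tangentCoordChange` is the derivative of the change between the charts centred at `p` and at
`chartPt p x`. The change is holomorphic, so `∂̄π`, defined at each point in its own chart, can be
computed in the single chart at `p`. -/
lemma dbarProj_tangentCoordChange (i : Fin (m + 1)) (p : FlagMfd t × FlagMfd t)
    (x τ : Nil t × Nil t) :
    dbarProj i (chartPt p x) (tangentCoordChange (𝓘(ℂ, Nil t).prod 𝓘(ℂ, Nil t)) p (chartPt p x)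
      (chartPt p x) τ) = dbarVec (projChart i p) x τ := by
  let q := chartPt p x
  let h : Nil t × Nil t → Nil t × Nil t := fun y =>
    extChartAt (𝓘(ℂ, Nil t).prod 𝓘(ℂ, Nil t)) q (chartPt p y)
  have h0 : HasFDerivWithinAt h (tangentCoordChange (𝓘(ℂ, Nil t).prod 𝓘(ℂ, Nil t)) p q q)
      (range (𝓘(ℂ, Nil t).prod 𝓘(ℂ, Nil t)))
      (extChartAt (𝓘(ℂ, Nil t).prod 𝓘(ℂ, Nil t)) p q) :=
    hasFDerivWithinAt_tangentCoordChange ⟨chartPt_mem_source p x, mem_extChartAt_source q⟩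
  rw [ModelWithCorners.range_eq_univ, hasFDerivWithinAt_univ, extChartAt_chartPt] at h0
  -- The projection depends only on the point, so its two coordinate expressions differ by the
  -- change of charts.
  have h1 : projChart i p =ᶠ[𝓝 x] fun y => projChart i q (h y) := by
    have hs : chartPt p ⁻¹' (extChartAt (𝓘(ℂ, Nil t).prod 𝓘(ℂ, Nil t)) q).source ∈ 𝓝 x :=
      (continuous_chartPt p).continuousAt (extChartAt_source_mem_nhds q)
    filter_upwards [hs] with y hy
    have : chartPt q (h y) = chartPt p y :=
      (extChartAt (𝓘(ℂ, Nil t).prod 𝓘(ℂ, Nil t)) q).left_inv hy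
    rw [projChart, projChart, this]
  exact ((dbarVec_congr h1 τ).trans
    (dbarVec_comp_holomorphic (differentiableAt_projChart i q _) h0 τ)).symm

/-- Only the middle factor is not holomorphic. The coefficients of both `γ_{0,i}` and `γ_{1,i}` have
this shape, with `Q` equal to `π` and to `∂̄π` along a constant vector. -/
lemma dbarVec_sandwich {E : Type*} [NormedAddCommGroup E] [NormedSpace ℂ E] {A Q : E → Mat N}
    {b : E → Vec N} {x : E} (hA : DifferentiableAt ℂ A x) (hQ : DifferentiableAt ℝ Q x)
    (hb : DifferentiableAt ℂ b x) (τ : E) :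
    dbarVec (fun y => A y (Q y (b y))) x τ = A x (dbarVec Q x τ (b x)) := by
  have h : DifferentiableAt ℝ (fun y => Q y (b y)) x :=
    (((ContinuousLinearMap.id ℂ (Mat N)).bilinearRestrictScalars ℝ).hasFDerivAt_of_bilinear
      hQ.hasFDerivAt (hb.restrictScalars ℝ).hasFDerivAt).differentiableAt
  rw [dbarVec_clm_apply (hA.restrictScalars ℝ) h, dbarVec_clm_apply hQ (hb.restrictScalars ℝ),
    dbarVec_of_differentiableAt hA, dbarVec_of_differentiableAt hb]
  simp

lemma contDiffAt_sandwich {E : Type*} [NormedAddCommGroup E] [NormedSpace ℂ E] {A Q : E → Mat N}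
    {b : E → Vec N} {x : E} (hA : ContDiffAt ℂ ∞ A x) (hQ : ContDiffAt ℝ ∞ Q x)
    (hb : ContDiffAt ℂ ∞ b x) : ContDiffAt ℝ ∞ (fun y => A y (Q y (b y))) x := by
  have happ : ContDiff ℝ ∞ fun r : Mat N × Vec N => r.1 r.2 :=
    ((ContinuousLinearMap.id ℂ (Mat N)).bilinearRestrictScalars ℝ).isBoundedBilinearMap.contDiff
  have h : ContDiffAt ℝ ∞ (fun y => Q y (b y)) x :=
    happ.contDiffAt.comp x (hQ.prodMk (hb.restrict_scalars ℝ))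
  exact happ.contDiffAt.comp x ((hA.restrict_scalars ℝ).prodMk h)

/-! ### The coefficients of `γ_{0,i}` and `γ_{1,i}` in holomorphic frames. -/

section Coeff

variable (i : Fin (m + 1)) (p : FlagMfd t × FlagMfd t)

lemma coe_coeff_gammaZero (e : Fin 0 → DiagModel t) (τ : Fin 0 → Nil t × Nil t)
    (v : TautModel t i) (x : Nil t × Nil t) :
    ((gammaZero t i).coeff (TautModel t i) (DiagModel t) p e τ v x : Vec N) =
      (frame p.1.rep x.1)⁻¹.val (projChart i p x ((frame p.2.rep x.2).val v.1)) := by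
  refine (coe_tautTriv_frame i p.1 x.1 _).trans ?_
  rw [← tautVal_tautTriv_symm_frame]
  rfl

/-- The factor `1 - π` of `perpLift` disappears because `∂̄π` annihilates the range of `π`. Without
it the vector to which `∂̄π` is applied is holomorphic. -/
lemma exists_coe_coeff_gammaOne : ∃ Λ : DiagModel t →L[ℂ] Mat N,
    ∀ (p : FlagMfd t × FlagMfd t) (e : Fin 1 → DiagModel t) (τ : Fin 1 → Nil t × Nil t)
      (v : TautModel t i) (x : Nil t × Nil t),
      ((gammaOne t i).coeff (TautModel t i) (DiagModel t) p e τ v x : Vec N) =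
        (frame p.1.rep x.1)⁻¹.val (dbarVec (projChart i p) x (τ 0)
          ((frame p.1.rep x.1).val (Λ (e 0) v.1))) := by
  obtain ⟨Λ, hΛ⟩ := exists_perpLift_chartPt (t := t) i
  refine ⟨Λ, fun p e τ v x => ?_⟩
  have h1 := hΛ p x ((trivializationAt (DiagModel t) (DiagBundle t) p).symmL ℂ (chartPt p x) (e 0))
    ((trivializationAt (TautModel t i) (Taut t i) p.2).symmL ℂ (chartPt p x).2 v)
  rw [Trivialization.continuousLinearMapAt_symmL _
      (by exact ⟨ofGL_frame_mem_source _ _, ofGL_frame_mem_source _ _⟩),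
    Trivialization.continuousLinearMapAt_symmL _ (by exact ofGL_frame_mem_source _ _)] at h1
  refine (coe_tautTriv_frame i p.1 x.1 _).trans (congrArg _ ?_)
  refine (tautVal_gammaOne i (chartPt p x) _ _ _).trans ?_
  refine (congrArg (dbarProj i (chartPt p x) _) h1).trans ?_
  refine (dbarProj_sub_projMat i (chartPt p x) _ _).trans ?_
  exact congrArg (fun A : Mat N => A ((frame p.1.rep x.1).val (Λ (e 0) v.1)))
    (dbarProj_tangentCoordChange i p x (τ 0))

variable {i p} in
/-- A function with values in the model fibre of `H_i` is as smooth as its values in `ℂ^N`. -/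
lemma contDiffAt_of_coe {f : Nil t × Nil t → TautModel t i} {x : Nil t × Nil t}
    (h : ContDiffAt ℝ ∞ (fun y => (f y : Vec N)) x) : ContDiffAt ℝ ∞ f x := by
  obtain ⟨ρ, hρ⟩ := exists_proj (t.refSub i)
  have e : f = fun y => ρ (f y : Vec N) := funext fun y => (hρ _).symm
  rw [e]
  exact (ρ.restrictScalars ℝ).contDiff.contDiffAt.comp x h

variable {i p} in
lemma coe_dbarVec {f : Nil t × Nil t → TautModel t i} {x : Nil t × Nil t}
    (h : ContDiffAt ℝ ∞ (fun y => (f y : Vec N)) x) (τ : Nil t × Nil t) :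
    ((dbarVec f x τ : TautModel t i) : Vec N) = dbarVec (fun y => (f y : Vec N)) x τ :=
  (dbarVec_clm_comp (t.refSub i).subtypeL
    ((contDiffAt_of_coe h).differentiableAt (by simp)) τ).symm

lemma contDiffAt_coe_coeff_gammaZero (e : Fin 0 → DiagModel t) (τ : Fin 0 → Nil t × Nil t)
    (v : TautModel t i) (x : Nil t × Nil t) : ContDiffAt ℝ ∞ (fun y =>
      ((gammaZero t i).coeff (TautModel t i) (DiagModel t) p e τ v y : Vec N)) x := by
  simp only [coe_coeff_gammaZero]
  exact contDiffAt_sandwich (contDiff_frame_inv_fst p ∞).contDiffAt (contDiffAt_projChart i p x)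
    ((contDiff_frame_snd p ∞).clm_apply contDiff_const).contDiffAt

lemma contDiffAt_coe_coeff_gammaOne (e : Fin 1 → DiagModel t) (τ : Fin 1 → Nil t × Nil t)
    (v : TautModel t i) (x : Nil t × Nil t) : ContDiffAt ℝ ∞ (fun y =>
      ((gammaOne t i).coeff (TautModel t i) (DiagModel t) p e τ v y : Vec N)) x := by
  obtain ⟨Λ, hΛ⟩ := exists_coe_coeff_gammaOne (t := t) i
  simp only [hΛ]
  exact contDiffAt_sandwich (contDiff_frame_inv_fst p ∞).contDiffAt
    (contDiffAt_dbarVec (contDiffAt_projChart i p x) _)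
    ((contDiff_frame_fst p ∞).clm_apply contDiff_const).contDiffAt

lemma coe_dbarVec_coeff_gammaZero (e : Fin 0 → DiagModel t) (τ : Fin 0 → Nil t × Nil t)
    (v : TautModel t i) (x σ : Nil t × Nil t) :
    ((dbarVec ((gammaZero t i).coeff (TautModel t i) (DiagModel t) p e τ v) x σ : TautModel t i) :
      Vec N) =
      (frame p.1.rep x.1)⁻¹.val (dbarVec (projChart i p) x σ ((frame p.2.rep x.2).val v.1)) := by
  rw [coe_dbarVec (contDiffAt_coe_coeff_gammaZero i p e τ v x)]
  simp only [coe_coeff_gammaZero]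
  exact dbarVec_sandwich ((contDiff_frame_inv_fst p 1).contDiffAt.differentiableAt (by simp))
    (differentiableAt_projChart i p x)
    (((contDiff_frame_snd p 1).clm_apply contDiff_const).contDiffAt.differentiableAt (by simp)) σ

/-- By `dbarVec_sandwich` both sides are second `∂̄`-derivatives of `π` between the same holomorphic
factors. -/
lemma dbarVec_coeff_gammaOne_comm (e : Fin 1 → DiagModel t) (τ σ : Nil t × Nil t)
    (v : TautModel t i) (x : Nil t × Nil t) :
    dbarVec ((gammaOne t i).coeff (TautModel t i) (DiagModel t) p e (fun _ => τ) v) x σ =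
      dbarVec ((gammaOne t i).coeff (TautModel t i) (DiagModel t) p e (fun _ => σ) v) x τ := by
  obtain ⟨Λ, hΛ⟩ := exists_coe_coeff_gammaOne (t := t) i
  have key : ∀ τ σ : Nil t × Nil t, ((dbarVec ((gammaOne t i).coeff (TautModel t i) (DiagModel t) p
      e (fun _ => τ) v) x σ : TautModel t i) : Vec N) = (frame p.1.rep x.1)⁻¹.val
        (dbarVec (fun y => dbarVec (projChart i p) y τ) x σ
          ((frame p.1.rep x.1).val (Λ (e 0) v.1))) := by
    intro τ σ
    rw [coe_dbarVec (contDiffAt_coe_coeff_gammaOne i p e _ v x)]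
    simp only [hΛ]
    exact dbarVec_sandwich ((contDiff_frame_inv_fst p 1).contDiffAt.differentiableAt (by simp))
      ((contDiffAt_dbarVec (contDiffAt_projChart i p x) τ).differentiableAt (by simp))
      (((contDiff_frame_fst p 1).clm_apply contDiff_const).contDiffAt.differentiableAt (by simp)) σ
  refine Subtype.ext ?_
  rw [key, key, dbarVec_comm (contDiffAt_projChart i p x)]

lemma tautVal_symmL_self (F : FlagMfd t) (c : TautModel t i) :
    tautVal i F ((trivializationAt (TautModel t i) (Taut t i) F).symmL ℂ F c)
      = (frame F.rep (flagChart F.rep F)).val c.1 := by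
  rw [tautTriv_symm i (mem_flagChart_rep F), tautVal_tautEquiv_symm]
  rfl

end Coeff

/-! ### The weight -/

lemma isSmooth_zero (i : Fin (m + 1)) (k q : ℕ) :
    PreForm.IsSmooth (I := 𝓘(ℂ, Nil t)) (V := Taut t i) (W := DiagBundle t)
      (TautModel t i) (DiagModel t) (k := k) (q := q) (fun _ _ _ _ => 0) where
  multilinear _ := ⟨0, fun _ _ _ => rfl⟩
  conj_smul _ _ _ _ _ := (smul_zero _).symm
  contDiffAt p₀ e τ v := by
    have h : PreForm.coeff (I := 𝓘(ℂ, Nil t)) (V := Taut t i) (W := DiagBundle t)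
        (TautModel t i) (DiagModel t) (k := k) (q := q) (fun _ _ _ _ => 0) p₀ e τ v
        = fun _ => 0 := funext fun x => map_zero _
    rw [h]
    exact contDiffAt_const

lemma dbar_zero (i : Fin (m + 1)) (k q : ℕ) (p : FlagMfd t × FlagMfd t)
    (e : Fin k → DiagBundle t p) (τ : Fin (q + 1) → Nil t × Nil t) (v : Taut t i p.2) :
    PreForm.dbar (I := 𝓘(ℂ, Nil t)) (V := Taut t i) (W := DiagBundle t)
      (TautModel t i) (DiagModel t) (k := k) (q := q) (fun _ _ _ _ => 0) p e τ v = 0 := by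
  have h : ∀ e τ v, PreForm.coeff (I := 𝓘(ℂ, Nil t)) (V := Taut t i) (W := DiagBundle t)
      (TautModel t i) (DiagModel t) (k := k) (q := q) (fun _ _ _ _ => 0) p e τ v
      = fun _ => 0 := fun e τ v => funext fun x => map_zero _
  unfold PreForm.dbar
  simp only [h]
  refine (congrArg _ (Finset.sum_eq_zero fun l _ => ?_)).trans (smul_zero _)
  rw [dbarVec_zero_fun, map_zero, smul_zero]

lemma isSmooth_gammaZero (i : Fin (m + 1)) :
    (gammaZero t i).IsSmooth (TautModel t i) (DiagModel t) where
  multilinear p := ⟨AlternatingMap.constOfIsEmpty ℂ _ _ (AlternatingMap.constOfIsEmpty ℝ _ _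
    (((p.1.V i).orthogonalProjectionOnto : Vec N →ₗ[ℂ] p.1.V i).comp (p.2.V i).subtype)),
    fun _ _ _ => rfl⟩
  conj_smul _ _ _ _ l := l.elim0
  contDiffAt p₀ e τ v := contDiffAt_of_coe (contDiffAt_coe_coeff_gammaZero i p₀ e τ v _)

/-- The value of `γ_{1,i}` at `p` as a homomorphism of fibres. -/
def gammaOneHom (i : Fin (m + 1)) (p : FlagMfd t × FlagMfd t) (e : DiagBundle t p)
    (τ : Nil t × Nil t) : Taut t i p.2 →ₗ[ℂ] Taut t i p.1 :=
  LinearMap.codRestrict (p.1.V i) ((dbarProj i p τ : Vec N →ₗ[ℂ] Vec N).comp (perpLift i p e))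
    fun _ => dbarProj_mem i p τ _

lemma hom_taut_ext {i : Fin (m + 1)} {p : FlagMfd t × FlagMfd t}
    {f g : Taut t i p.2 →ₗ[ℂ] Taut t i p.1} (h : ∀ v, tautVal i p.1 (f v) = tautVal i p.1 (g v)) :
    f = g := LinearMap.ext fun v => tautVal_injective i p.1 (h v)

/-- In `(∂̄π)(τ) φ_i(ξ_i(v))` the dependence on `ξ` and `v` is complex linear, and that on `τ` is
conjugate linear since `∂̄` is. -/
lemma isSmooth_gammaOne (i : Fin (m + 1)) :
    (gammaOne t i).IsSmooth (TautModel t i) (DiagModel t) where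
  multilinear p := by
    let f : DiagBundle t p → (TangentSpace (𝓘(ℂ, Nil t).prod 𝓘(ℂ, Nil t)) p →ₗ[ℝ]
        (Taut t i p.2 →ₗ[ℂ] Taut t i p.1)) := fun e =>
      { toFun := fun τ => gammaOneHom i p e τ
        map_add' := fun τ σ => hom_taut_ext fun v => by
          rw [LinearMap.add_apply, map_add]
          exact congrArg (fun A : Mat N => A (perpLift i p e v)) (dbarVec_add_right _ _ _ _)
        map_smul' := fun c τ => hom_taut_ext fun v => by
          refine Eq.trans ?_ ((tautVal i p.1).map_smul_of_tower c _).symm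
          exact congrArg (fun A : Mat N => A (perpLift i p e v)) (dbarVec_smul_right _ _ _ _) }
    have hf : ∀ e τ v, tautVal i p.1 (f e τ v) = dbarProj i p τ (perpLift i p e v) :=
      fun _ _ _ => rfl
    refine ⟨AlternatingMap.ofSubsingleton ℂ _ _ 0
      { toFun := fun e => AlternatingMap.ofSubsingleton ℝ _ _ 0 (f e)
        map_add' := fun e e' => ?_
        map_smul' := fun c e => ?_ }, fun e τ v => ?_⟩
    · refine AlternatingMap.ext fun τ => hom_taut_ext fun v => ?_
      refine (hf _ _ _).trans (Eq.trans ?_ (map_add (tautVal i p.1) _ _).symm)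
      refine Eq.trans ?_ (congrArg₂ (· + ·) (hf e (τ 0) v) (hf e' (τ 0) v)).symm
      rw [map_add, LinearMap.add_apply, map_add]
    · refine AlternatingMap.ext fun τ => hom_taut_ext fun v => ?_
      refine (hf _ _ _).trans (Eq.trans ?_ (map_smul (tautVal i p.1) c _).symm)
      refine Eq.trans ?_ (congrArg (c • ·) (hf e (τ 0) v)).symm
      rw [map_smul, LinearMap.smul_apply, map_smul]
    · exact tautVal_injective i p.1 ((tautVal_gammaOne i p e τ v).trans (hf _ _ _).symm)
  conj_smul p e τ v l := by
    obtain rfl : l = 0 := Subsingleton.elim _ _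
    refine tautVal_injective i p.1 ?_
    rw [map_smul]
    refine (tautVal_gammaOne i p e _ v).trans ?_
    refine Eq.trans ?_ (congrArg (-Complex.I • ·) (tautVal_gammaOne i p e τ v)).symm
    rw [Function.update_self]
    exact congrArg (fun A : Mat N => A (perpLift i p (e 0) v)) (dbarVec_I_smul _ _ _)
  contDiffAt p₀ e τ v := contDiffAt_of_coe (contDiffAt_coe_coeff_gammaOne i p₀ e τ v _)

/-- For the last index both sides vanish, since the last member of a flag is all of `ℂ^N`; so the
convention for the last component agrees with `η`. -/
lemma component_eta (i : Fin (m + 1)) (p : FlagMfd t × FlagMfd t) (v : p.2.V i) :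
    component (eta p) i v = (p.1.V i).mkQ v.1 := by
  induction i using Fin.lastCases with
  | last =>
    rw [component_last, LinearMap.zero_apply]
    refine ((Submodule.Quotient.mk_eq_zero _).2 ?_).symm
    rw [p.1.V_last]
    trivial
  | cast j => rw [component_castSucc]; rfl

/-- Both sides equal `(∂̄π) v`: on the left `(∂̄π)(v - πv) = (∂̄π) v`, and on the right the frames
of `H_{i,z}` and `H_{i,ζ}` are holomorphic and contribute no derivative. -/
lemma contract_eta_gammaOne_eq_dbar_gammaZero (i : Fin (m + 1)) (p : FlagMfd t × FlagMfd t)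
    (e : Fin 0 → DiagBundle t p) (τ : Fin 1 → Nil t × Nil t) (v : Taut t i p.2) :
    (gammaOne t i).contract eta p e τ v
      = (gammaZero t i).dbar (TautModel t i) (DiagModel t) p e τ v := by
  refine tautVal_injective i p.1 ?_
  have h1 : perpLift i p (eta p) v = tautVal i _ v - projMat i p.1 (tautVal i _ v) :=
    perpLift_of_component (component_eta i p v)
  have h2 : tautVal i p.1 ((gammaOne t i).contract eta p e τ v)
      = dbarProj i p (τ 0) (tautVal i _ v) := by
    refine (tautVal_gammaOne i p _ τ v).trans ?_
    rw [Matrix.cons_val_zero, h1, dbarProj_sub_projMat]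
  rw [h2]
  unfold PreForm.dbar
  rw [pow_zero, one_smul, Fin.sum_univ_one, Fin.val_zero, pow_zero, one_smul, tautVal_symmL_self,
    coe_dbarVec_coeff_gammaZero]
  have h3 := tautVal_symmL_self i p.2
    ((trivializationAt (TautModel t i) (Taut t i) p.2).continuousLinearMapAt ℂ p.2 v)
  rw [tautTriv_symmL_self] at h3
  have h4 : (frame p.2.rep (centre p).2).val
      ((trivializationAt (TautModel t i) (Taut t i) p.2).continuousLinearMapAt ℂ p.2 v :
        TautModel t i).1 = tautVal i p.2 v := h3.symm
  rw [h4]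
  -- The frame that returns from coordinates to `H_{i,z}` cancels the inverse frame in the
  -- coefficient.
  exact (apply_inv_apply (frame p.1.rep (centre p).1) _).symm

/-- The alternating sum has two terms of opposite sign, equal by the symmetry of `∂̄² π`. -/
lemma dbar_gammaOne (i : Fin (m + 1)) (p : FlagMfd t × FlagMfd t)
    (e : Fin 1 → DiagBundle t p) (τ : Fin 2 → Nil t × Nil t) (v : Taut t i p.2) :
    (gammaOne t i).dbar (TautModel t i) (DiagModel t) p e τ v = 0 := by
  unfold PreForm.dbar
  -- Omitting one of two vectors leaves the other, so each term is a coefficient along a single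
  -- constant vector.
  have h0 : (fun j : Fin 1 => τ ((0 : Fin 2).succAbove j)) = fun _ => τ 1 := by
    funext j; fin_cases j; rfl
  have h1 : (fun j : Fin 1 => τ ((1 : Fin 2).succAbove j)) = fun _ => τ 0 := by
    funext j; fin_cases j; rfl
  rw [Fin.sum_univ_two, h0, h1, dbarVec_coeff_gammaOne_comm i p _ (τ 1) (τ 0)]
  simp

theorem isWeight_weightG (i : Fin (m + 1)) :
    IsWeight (I := 𝓘(ℂ, Nil t)) (V := Taut t i) (W := DiagBundle t)
      (TautModel t i) (DiagModel t) eta (weightG t i) where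
  smooth k q := by
    rcases k with _ | _ | k <;> rcases q with _ | _ | q
    · exact isSmooth_gammaZero i
    -- With the case `(0, 0)` closed, the fourth remaining bidegree is `(1, 1)`.
    on_goal 4 => exact isSmooth_gammaOne i
    all_goals exact isSmooth_zero i _ _
  eq_zero k q h p e τ v := by
    rcases k with _ | _ | k <;> rcases q with _ | _ | q
    all_goals first | rfl | exact absurd rfl h
  nabla_eq_zero k q p e τ v := by
    rcases q with _ | q
    · rcases k with _ | k <;> rfl
    rcases k with _ | _ | k <;> rcases q with _ | _ | q
    · exact sub_eq_zero.2 (contract_eta_gammaOne_eq_dbar_gammaZero i p e τ v)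
    -- Here `q` has been lowered by one, so this is bidegree `(1, 2)`, where the contracted
    -- component is zero and `∂̄γ_{1,i}` remains. In the other cases both terms come from zero
    -- components.
    on_goal 4 => exact sub_eq_zero.2 (dbar_gammaOne i p e τ v).symm
    all_goals exact sub_eq_zero.2 (dbar_zero i _ _ p e τ v).symm
  diagonal z e τ v := tautVal_injective i z (projMat_eq_self (tautVal_mem v))

end

end FlagManifold

theorem mainTheorem6 {m N : ℕ} (t : FlagType m N) (i : Fin (m + 1)) :
    (∀ (p : FlagMfd t × FlagMfd t) (ξ : ∀ p, DiagBundle t p) (v : ∀ p : FlagMfd t × FlagMfd t, Taut t i p.2),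
      SmoothSectionAt (DiagModel t) 𝓘(ℂ, Nil t) ξ p →
      SmoothPullbackSectionAt (TautModel t i) 𝓘(ℂ, Nil t) v p →
      ∀ τ : TangentSpace (𝓘(ℂ, Nil t).prod 𝓘(ℂ, Nil t)) p,
        gammaOne t i p (fun _ => ξ p) (fun _ => τ) (v p) = gammaOneOp i ξ v p τ) ∧
    IsWeight (I := 𝓘(ℂ, Nil t)) (V := Taut t i) (W := DiagBundle t)
      (TautModel t i) (DiagModel t) eta (weightG t i) := by
  exact ⟨fun p ξ v hξ hv τ => gammaOne_eq_gammaOneOp i p ξ v hξ hv τ, isWeight_weightG i⟩
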